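/- Let $[n]=\{1,\dots,n\}$. A matching in a family $\mathcal F$ of subsets of $[n]$ is a collection of pairwise disjoint members of $\mathcal F$; it covers $B\subseteq[n]$ if every element of $B$ lies in one of its members, and it is perfect if it covers $[n]$. If $n=ks$ and $\mathcal F$ consists of $k$-subsets of $[n]$, a blocking set of $\mathcal F$ is a set $B\subseteq[n]$ with $|B|\le s$ that cannot be covered by a matching in $\mathcal F$ of size exactly $|B|$. Given pairwise disjoint $(k-1)$-subsets $E_1,\dots,E_{b-1}$ of $[n]\setminus[b]$, put, for $1\le i\le b$, $$\mathcal E_i=\big\{\{i\}\cup E_i\big\}\cup\big\{\{i\}\cup S:\ S\subseteq\{i+1,\dots,n\},\ |S|=k-1,\ S\cap(E_1\cup\dots\cup E_{i-1})\ne\emptyset\big\}$$ (omitting the set $\{i\}\cup E_i$ when $i=b$), and $$\mathcal E(k,n,b)=\big\{T\subseteq\{b+1,\dots,n\}:\ |T|=k\big\}\cup\bigcup_{i=1}^{b}\mathcal E_i .$$ Up to a permutation of $[n]$ this family does not depend on the choice of the $E_i$. Theorem. There is a function $s_0(k,b)$ such that the following holds for all positive integers $k,b$ with $k\ge100$ or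 $k\ge\max\{b+1,6\}$, all $s\ge s_0(k,b)$, $n=ks$, and every choice of $E_1,\dots,E_{b-1}$ as above. The family $\mathcal E(k,n,b)$ has no perfect matching and no blocking set of size less than $b$; and every family $\mathcal F$ of $k$-subsets of $[n]$ with no perfect matching and no blocking set of size less than $b$ satisfies $$|\mathcal F|\le|\mathcal E(k,n,b)| .$$ Moreover, if $|\mathcal F|=|\mathcal E(k,n,b)|$, then $\mathcal F$ is the image of $\mathcal E(k,n,b)$ under a permutation of $[n]$. -/

import Mathlib

/-! Families of `k`-subsets of an `n`-element vertex set. The vertex set `[n] = {1, …, n}` is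
represented by `Fin n`; the vertex `i ∈ [n]` is the element of `Fin n` with value `i - 1`, so the
initial segment `[b] = {1, …, b}` consists of the `v : Fin n` with `v.val < b`. -/

/-- `M` is a matching in the family `F`: a collection of pairwise disjoint members of `F`. -/
def IsMatchingIn {n : ℕ} (F M : Finset (Finset (Fin n))) : Prop :=
  M ⊆ F ∧ ∀ S ∈ M, ∀ T ∈ M, S ≠ T → Disjoint S T

/-- The collection `M` covers the vertex set `B`: each element of `B` lies in a member of `M`. -/
def Covers {n : ℕ} (M : Finset (Finset (Fin n))) (B : Finset (Fin n)) : Prop :=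
  ∀ v ∈ B, ∃ S ∈ M, v ∈ S

/-- `F` has a perfect matching: a matching in `F` that covers all vertices. -/
def HasPerfectMatching {n : ℕ} (F : Finset (Finset (Fin n))) : Prop :=
  ∃ M : Finset (Finset (Fin n)), IsMatchingIn F M ∧ Covers M Finset.univ

/-- `B` is a blocking set of `F` (a family of `k`-subsets of an `n`-set with `n = k * s`):
`B` has at most `s` elements and cannot be covered by a matching in `F` of size `|B|`. -/
def IsBlockingSet {n : ℕ} (s : ℕ) (F : Finset (Finset (Fin n))) (B : Finset (Fin n)) : Prop :=
  B.card ≤ s ∧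
    ¬ ∃ M : Finset (Finset (Fin n)), IsMatchingIn F M ∧ M.card = B.card ∧ Covers M B

/-- `F` is a family of `k`-sets with no perfect matching and no blocking set of size less
than `b`. -/
def IsAdmissible {n : ℕ} (k s b : ℕ) (F : Finset (Finset (Fin n))) : Prop :=
  (∀ S ∈ F, S.card = k) ∧ ¬ HasPerfectMatching F ∧
    ∀ B : Finset (Fin n), B.card < b → ¬ IsBlockingSet s F B

/-- `E` lists `b - 1` pairwise disjoint `(k - 1)`-sets, none of which meets `[b]`. The set `E j`,
for `j = 0, …, b - 2`, is the set with number `j + 1` in one-based numbering. -/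
def IsBaseSystem {n : ℕ} (k b : ℕ) (E : Fin (b - 1) → Finset (Fin n)) : Prop :=
  (∀ j, (E j).card = k - 1) ∧ (∀ j, ∀ v ∈ E j, b ≤ v.val) ∧
    ∀ i j, i ≠ j → Disjoint (E i) (E j)

open Classical in
/-- The part of the construction belonging to the vertex `i` of `[b]`: the set `{i} ∪ E_i` (there
is no such set for the last vertex of `[b]`), together with all `k`-sets whose least element is `i`
and which meet some `E_j` with `j < i`. -/
noncomputable def franklPart {n : ℕ} (k b : ℕ) (E : Fin (b - 1) → Finset (Fin n)) (i : Fin n) :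
    Finset (Finset (Fin n)) :=
  Finset.univ.filter fun S =>
    (∃ j : Fin (b - 1), j.val = i.val ∧ S = insert i (E j)) ∨
    (S.card = k ∧ i ∈ S ∧ (∀ v ∈ S, i ≤ v) ∧
      ∃ j : Fin (b - 1), j.val < i.val ∧ ¬ Disjoint S (E j))

open Classical in
/-- The family `𝓔(k, n, b)` built from the sets `E`: all `k`-sets that do not meet `[b]`, together
with the parts belonging to the vertices of `[b]`. -/
noncomputable def franklFamily {n : ℕ} (k b : ℕ) (E : Fin (b - 1) → Finset (Fin n)) :
    Finset (Finset (Fin n)) :=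
  (Finset.univ.filter fun S : Finset (Fin n) => S.card = k ∧ ∀ v ∈ S, b ≤ v.val) ∪
    (Finset.univ.filter fun i : Fin n => i.val < b).biUnion (franklPart k b E)

/-!
Let `F` be an admissible family at least as large as the extremal family. It suffices to embed `F`
into a copy of the extremal family; this gives both the bound and uniqueness.

*Localization.* At most `b * C(n-1, k-1)` of the `k`-sets are missing from `F`, so
only boundedly many vertices have a large missing degree. If those could be covered by a matching,
the remaining vertices would have a perfect matching
(`exists_matching_of_small_missing_degree`, by augmenting a maximum matching). Hence they contain a
minimal set `B` not covered by any matching of size at most `|B|`. All edges at a vertex of `B` meet a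
set of bounded size, so its degree is `O(n^(k-2))`, and counting missing sets gives `|B| ≤ b`;
admissibility gives `|B| = b` (`IsAdmissible.exists_minimal_uncoverable`).

*Counting.* Call a pair heavy if its codegree is large enough that it extends to an edge avoiding any
`k * b` further vertices. Up to `O(n^(k-3))`, the number of edges that meet `B` is at most `C(n-2, k-2)` times the
number of heavy pairs that meet `B`. Given `C ⊂ B` and a matching `M` with at most `|C|` edges that
covers `C`, heavy pairs outside `M` cannot be disjoint and cover the rest of `B`, so
`exists_pairing_or_low_degree` yields a nonempty `A ⊆ B` outside `M` whose vertices have fewer than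
`|A|` heavy neighbours outside `M`, hence at most `(k-1)|C| + |A| - 1` outside `C`. Adding such sets
`A` successively until `B` is exhausted bounds the number of heavy pairs by `(k-1) * C(b, 2)`, and for
`k ≥ 4` any step with `|A| > 1`, or with fewer heavy neighbours than allowed, loses a full term
`C(n-2, k-2)`. The extremal family attains this main term (`le_card_franklFamily`), so for large `s`
no step loses (`meetingBound_lt_of_subset`, `exists_next_vertex`).

*Rigidity.* Therefore `B` is listed as `v 0, …, v (b-1)` such that every matching with at most `i`
edges covering `v 0, …, v (i-1)` avoids `v i` and has a vertex set that does not depend on the matching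
(`exists_rigid_enumeration`). The edges `{v i} ∪ E i` of one matching that covers all but the last
vertex then force every edge whose first vertex in `B` is `v i` to equal `{v i} ∪ E i` or to meet an
earlier `E j` (`exists_extremal_structure`): this is the extremal family up to a permutation.
-/

/-! ### Pairings in graphs with no small set of low-degree vertices -/

/-- A Hall-type condition for pairings: if no nonempty `A ⊆ B` consists of vertices with fewer than
`|A|` neighbours, then disjoint pairs `(v, x)` with `v ∈ B` and `x ∈ N v` cover `B`. Both entries of
a pair may lie in `B`. The proof removes a vertex of degree at least `|B|`, pairs up the rest, and
then augments. -/
theorem exists_pairing_or_low_degree {V : Type*} [DecidableEq V] (N : V → Finset V)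
    (hN : ∀ v, v ∉ N v) (B : Finset V)
    (hB : ∀ A ⊆ B, A.Nonempty → ∃ v ∈ A, A.card ≤ (N v).card) :
    ∃ P : Finset (V × V), (∀ p ∈ P, p.1 ∈ B ∧ p.2 ∈ N p.1) ∧
      (∀ p ∈ P, ∀ q ∈ P, p ≠ q → Disjoint ({p.1, p.2} : Finset V) {q.1, q.2}) ∧
      ∀ v ∈ B, ∃ p ∈ P, v = p.1 ∨ v = p.2 := by
  induction' hc : B.card with m ih generalizing B
  · refine ⟨∅, by simp, by simp, ?_⟩
    rw [Finset.card_eq_zero] at hc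
    simp [hc]
  · obtain ⟨v, hv, hdeg⟩ := hB B subset_rfl (Finset.card_pos.1 (by omega))
    obtain ⟨P, hP, hdis, hcov⟩ := ih (B.erase v)
      (fun A hA => hB A (hA.trans (Finset.erase_subset _ _)))
      (by rw [Finset.card_erase_of_mem hv, hc]; rfl)
    have hP1 : ∀ p ∈ P, p.1 ∈ B := fun p hp => Finset.mem_of_mem_erase (hP p hp).1
    by_cases hvc : ∃ p ∈ P, v = p.1 ∨ v = p.2
    · refine ⟨P, fun p hp => ⟨hP1 p hp, (hP p hp).2⟩, hdis, fun u hu => ?_⟩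
      by_cases huv : u = v
      · rwa [huv]
      · exact hcov u (Finset.mem_erase.2 ⟨huv, hu⟩)
    push Not at hvc
    by_cases hfree : ∃ x ∈ N v, ∀ p ∈ P, x ≠ p.1 ∧ x ≠ p.2
    · obtain ⟨x, hx, hxP⟩ := hfree
      refine ⟨insert (v, x) P, ?_, ?_, ?_⟩
      · intro p hp
        rcases Finset.mem_insert.1 hp with rfl | hp
        · exact ⟨hv, hx⟩
        · exact ⟨hP1 p hp, (hP p hp).2⟩
      · have key : ∀ q ∈ P, Disjoint ({v, x} : Finset V) {q.1, q.2} := by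
          intro q hq
          simp [(hvc q hq).1.symm, (hvc q hq).2.symm, (hxP q hq).1.symm, (hxP q hq).2.symm]
        intro p hp q hq hpq
        rcases Finset.mem_insert.1 hp with rfl | hp <;> rcases Finset.mem_insert.1 hq with rfl | hq
        · exact absurd rfl hpq
        · exact key q hq
        · exact (key p hp).symm
        · exact hdis p hp q hq hpq
      · intro u hu
        by_cases huv : u = v
        · exact ⟨(v, x), Finset.mem_insert_self _ _, Or.inl huv⟩
        · obtain ⟨p, hp, h⟩ := hcov u (Finset.mem_erase.2 ⟨huv, hu⟩)
          exact ⟨p, Finset.mem_insert_of_mem hp, h⟩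
    push Not at hfree
    -- If `p.1` is a neighbour of `v` and `p.2` need not be covered, `v` takes over `p.1` as partner.
    by_cases hswap : ∃ p ∈ P, p.1 ∈ N v ∧ p.2 ∉ B
    · obtain ⟨p, hp, hpN, hpB⟩ := hswap
      refine ⟨insert (v, p.1) (P.erase p), ?_, ?_, ?_⟩
      · intro q hq
        rcases Finset.mem_insert.1 hq with rfl | hq
        · exact ⟨hv, hpN⟩
        · have hq := Finset.mem_of_mem_erase hq
          exact ⟨hP1 q hq, (hP q hq).2⟩
      · have key : ∀ q ∈ P.erase p, Disjoint ({v, p.1} : Finset V) {q.1, q.2} := by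
          intro q hq
          obtain ⟨hqp, hq⟩ := Finset.mem_erase.1 hq
          have h1 := hdis p hp q hq hqp.symm
          rw [Finset.disjoint_insert_left] at h1 ⊢
          refine ⟨?_, ?_⟩
          · simpa using hvc q hq
          · simpa using h1.1
        intro q hq r hr hqr
        rcases Finset.mem_insert.1 hq with rfl | hq <;> rcases Finset.mem_insert.1 hr with rfl | hr
        · exact absurd rfl hqr
        · exact key r hr
        · exact (key q hq).symm
        · exact hdis q (Finset.mem_of_mem_erase hq) r (Finset.mem_of_mem_erase hr) hqr
      · intro u hu
        by_cases huv : u = v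
        · exact ⟨(v, p.1), Finset.mem_insert_self _ _, Or.inl huv⟩
        · obtain ⟨q, hq, h⟩ := hcov u (Finset.mem_erase.2 ⟨huv, hu⟩)
          by_cases hqp : q = p
          · subst hqp
            rcases h with h | h
            · exact ⟨(v, q.1), Finset.mem_insert_self _ _, Or.inr h⟩
            · exact absurd (h ▸ hu) hpB
          · exact ⟨q, Finset.mem_insert_of_mem (Finset.mem_erase.2 ⟨hqp, hq⟩), h⟩
    push Not at hswap
    -- Each neighbour of `v` outside `B` is paired with a vertex of `B` outside `N v`, so that `N v`
    -- has at most `|B| - 1` elements.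
    exfalso
    have hle : (N v \ B.erase v).card ≤ (B.erase v \ N v).card := by
      have hsel : ∀ x ∈ N v \ B.erase v, ∃ p ∈ P, x = p.2 ∧ p.1 ∈ B.erase v \ N v := by
        intro x hx
        obtain ⟨hx, hxB⟩ := Finset.mem_sdiff.1 hx
        have hxv : x ≠ v := fun h => hN v (h ▸ hx)
        obtain ⟨p, hp, h⟩ : ∃ p ∈ P, x = p.1 ∨ x = p.2 := by
          obtain ⟨p, hp, h⟩ := hfree x hx
          exact ⟨p, hp, by tauto⟩
        have h2 : x = p.2 := h.resolve_left fun h => hxB (h ▸ (hP p hp).1)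
        refine ⟨p, hp, h2, Finset.mem_sdiff.2 ⟨(hP p hp).1, fun h1 => hxB ?_⟩⟩
        exact Finset.mem_erase.2 ⟨hxv, h2 ▸ hswap p hp h1⟩
      choose! p hpP hp2 hp1 using hsel
      refine Finset.card_le_card_of_injOn (fun x => (p x).1) (fun x hx => hp1 x hx) ?_
      intro x hx y hy hxy
      have : p x = p y := by
        by_contra hne
        have := hdis _ (hpP x hx) _ (hpP y hy) hne
        rw [Finset.disjoint_left] at this
        exact this (Finset.mem_insert_self _ _) (by simp only at hxy; simp [hxy])
      rw [hp2 x hx, hp2 y hy, this]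
    have h1 := Finset.card_sdiff_add_card_inter (N v) (B.erase v)
    have h2 := Finset.card_sdiff_add_card_inter (B.erase v) (N v)
    rw [Finset.inter_comm] at h2
    have h3 := Finset.card_erase_of_mem hv
    omega

/-! ### Matchings and heavy pairs -/

theorem card_filter_superset_le {V : Type*} [Fintype V] [DecidableEq V] {k : ℕ}
    (F : Finset (Finset V)) (hF : ∀ S ∈ F, S.card = k) (R : Finset V) :
    (F.filter (R ⊆ ·)).card ≤ (Fintype.card V - R.card).choose (k - R.card) := by
  rw [← Finset.card_univ, ← Finset.card_sdiff_of_subset (Finset.subset_univ R),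
    ← Finset.card_powersetCard]
  refine Finset.card_le_card_of_injOn (· \ R) ?_ ?_
  · intro S hS
    obtain ⟨hS, hR⟩ := Finset.mem_filter.1 hS
    refine Finset.mem_powersetCard.2 ⟨Finset.sdiff_subset_sdiff (Finset.subset_univ _) subset_rfl, ?_⟩
    rw [Finset.card_sdiff_of_subset hR, hF S hS]
  · intro S hS T hT h
    rw [← Finset.sdiff_union_of_subset (Finset.mem_filter.1 hS).2,
      ← Finset.sdiff_union_of_subset (Finset.mem_filter.1 hT).2]
    exact congrArg (· ∪ R) h

theorem card_biUnion_matching_le {n k : ℕ} {F M : Finset (Finset (Fin n))}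
    (hF : ∀ S ∈ F, S.card = k) (hM : IsMatchingIn F M) :
    (M.biUnion id).card ≤ k * M.card := by
  rw [mul_comm]
  exact Finset.card_biUnion_le_card_mul _ _ _ fun S hS => (hF S (hM.1 hS)).le

theorem card_biUnion_matching {n k : ℕ} {F M : Finset (Finset (Fin n))}
    (hF : ∀ S ∈ F, S.card = k) (hM : IsMatchingIn F M) :
    (M.biUnion id).card = k * M.card := by
  rw [Finset.card_biUnion (t := id) (fun S hS T hT h => hM.2 S hS T hT h),
    mul_comm]
  exact Finset.sum_const_nat fun S hS => hF S (hM.1 hS)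

theorem IsMatchingIn.insert {n : ℕ} {F M : Finset (Finset (Fin n))} (hM : IsMatchingIn F M)
    {S : Finset (Fin n)} (hS : S ∈ F) (hd : Disjoint S (M.biUnion id)) :
    IsMatchingIn F (insert S M) := by
  have key : ∀ T ∈ M, Disjoint S T := fun T hT =>
    hd.mono_right (Finset.subset_biUnion_of_mem id hT)
  refine ⟨Finset.insert_subset hS hM.1, fun T hT U hU hne => ?_⟩
  rcases Finset.mem_insert.1 hT with hTS | hTM <;> rcases Finset.mem_insert.1 hU with hUS | hUM
  · exact absurd (hTS.trans hUS.symm) hne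
  · exact hTS ▸ key U hUM
  · exact hUS ▸ (key T hTM).symm
  · exact hM.2 T hTM U hUM hne

theorem IsMatchingIn.mono {n : ℕ} {F M M' : Finset (Finset (Fin n))} (hM : IsMatchingIn F M)
    (h : M' ⊆ M) : IsMatchingIn F M' :=
  ⟨h.trans hM.1, fun S hS T hT => hM.2 S (h hS) T (h hT)⟩

theorem covers_iff_subset {n : ℕ} {M : Finset (Finset (Fin n))} {B : Finset (Fin n)} :
    Covers M B ↔ B ⊆ M.biUnion id := by
  simp [Covers, Finset.subset_iff]

/-- The vertices `x` whose codegree with `v` exceeds `q`. -/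
def heavyNbrs {n : ℕ} (F : Finset (Finset (Fin n))) (q : ℕ) (v : Fin n) : Finset (Fin n) :=
  Finset.univ.filter fun x => x ≠ v ∧ q < (F.filter ({v, x} ⊆ ·)).card

theorem exists_edge_avoiding {n k : ℕ} {F : Finset (Finset (Fin n))} (hF : ∀ S ∈ F, S.card = k)
    {m : ℕ} {v x : Fin n} (hx : x ∈ heavyNbrs F (m * (n - 3).choose (k - 3)) v)
    {Y : Finset (Fin n)} (hY : Y.card ≤ m) (hvY : v ∉ Y) (hxY : x ∉ Y) :
    ∃ S ∈ F, v ∈ S ∧ x ∈ S ∧ Disjoint S Y := by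
  obtain ⟨-, hxv, hlt⟩ := Finset.mem_filter.1 hx
  by_contra! hno
  have hsub : F.filter ({v, x} ⊆ ·) ⊆ Y.biUnion fun y => F.filter ({v, x, y} ⊆ ·) := by
    intro S hS
    obtain ⟨hS, hR⟩ := Finset.mem_filter.1 hS
    have hvS : v ∈ S := hR (by simp)
    have hxS : x ∈ S := hR (by simp)
    obtain ⟨y, hyS, hyY⟩ := Finset.not_disjoint_iff.1 (hno S hS hvS hxS)
    refine Finset.mem_biUnion.2 ⟨y, hyY, Finset.mem_filter.2 ⟨hS, ?_⟩⟩
    simp [Finset.insert_subset_iff, hvS, hxS, hyS]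
  have h1 : (F.filter ({v, x} ⊆ ·)).card ≤ Y.card * (n - 3).choose (k - 3) := by
    refine (Finset.card_le_card hsub).trans (Finset.card_biUnion_le_card_mul _ _ _ fun y hy => ?_)
    have h3 : ({v, x, y} : Finset (Fin n)).card = 3 := by
      rw [Finset.card_eq_three]
      exact ⟨v, x, y, hxv.symm, fun h => hvY (h ▸ hy), fun h => hxY (h ▸ hy), rfl⟩
    simpa [h3] using card_filter_superset_le F hF {v, x, y}
  have := Nat.mul_le_mul_right ((n - 3).choose (k - 3)) hY
  omega

/-- Heavy pairs extend greedily: a matching and a disjoint pairing of heavy pairs outside it give a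
matching that covers both. -/
theorem exists_matching_of_pairing {n k m : ℕ} {F : Finset (Finset (Fin n))} (hk : 2 ≤ k)
    (hF : ∀ S ∈ F, S.card = k) (P : Finset (Fin n × Fin n)) :
    ∀ M : Finset (Finset (Fin n)), IsMatchingIn F M → k * (M.card + P.card) ≤ m →
    (∀ p ∈ P, p.2 ∈ heavyNbrs F (m * (n - 3).choose (k - 3)) p.1) →
    (∀ p ∈ P, p.1 ∉ M.biUnion id ∧ p.2 ∉ M.biUnion id) →
    (∀ p ∈ P, ∀ q ∈ P, p ≠ q → Disjoint ({p.1, p.2} : Finset (Fin n)) {q.1, q.2}) →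
    ∃ M', IsMatchingIn F M' ∧ M'.card ≤ M.card + P.card ∧ M.biUnion id ⊆ M'.biUnion id ∧
      ∀ p ∈ P, p.1 ∈ M'.biUnion id ∧ p.2 ∈ M'.biUnion id := by
  induction P using Finset.induction_on with
  | empty => exact fun M hM _ _ _ _ => ⟨M, hM, by simp, subset_rfl, by simp⟩
  | insert p P hpP ih =>
    intro M hM hm hh hout hdis
    rw [Finset.card_insert_of_notMem hpP] at hm ⊢
    have hp := Finset.mem_insert_self p P
    set Y := M.biUnion id ∪ P.biUnion fun q => {q.1, q.2} with hYdef
    have hY : Y.card ≤ m := by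
      have h1 := card_biUnion_matching_le hF hM
      have h2 : (P.biUnion fun q => ({q.1, q.2} : Finset (Fin n))).card ≤ P.card * 2 :=
        Finset.card_biUnion_le_card_mul _ _ _ fun q _ => Finset.card_le_two
      have h3 : P.card * 2 ≤ P.card * k := Nat.mul_le_mul_left _ hk
      have h4 := Finset.card_union_le (M.biUnion id) (P.biUnion fun q => ({q.1, q.2} : Finset (Fin n)))
      rw [← hYdef] at h4
      nlinarith
    have hq : ∀ q ∈ P, Disjoint ({p.1, p.2} : Finset (Fin n)) {q.1, q.2} := fun q hq =>
      hdis p hp q (Finset.mem_insert_of_mem hq) fun h => hpP (h ▸ hq)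
    have hpY : ∀ z ∈ ({p.1, p.2} : Finset (Fin n)), z ∉ P.biUnion fun q => {q.1, q.2} := by
      intro z hz hz'
      obtain ⟨q, hqP, hzq⟩ := Finset.mem_biUnion.1 hz'
      exact Finset.disjoint_left.1 (hq q hqP) hz hzq
    obtain ⟨S, hS, h1S, h2S, hSY⟩ := exists_edge_avoiding hF (hh p hp) hY
      (by simp only [hYdef, Finset.mem_union, not_or]; exact ⟨(hout p hp).1, hpY _ (by simp)⟩)
      (by simp only [hYdef, Finset.mem_union, not_or]; exact ⟨(hout p hp).2, hpY _ (by simp)⟩)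
    have hSM : Disjoint S (M.biUnion id) := hSY.mono_right Finset.subset_union_left
    have hcard : (insert S M).card ≤ M.card + 1 := Finset.card_insert_le _ _
    have hSq : ∀ q ∈ P, q.1 ∉ S ∧ q.2 ∉ S := by
      intro q hq
      constructor <;> intro h <;> refine Finset.disjoint_left.1 hSY h
        (Finset.mem_union_right _ (Finset.mem_biUnion.2 ⟨q, hq, by simp⟩))
    obtain ⟨M', hM', hc', hsub, hcov⟩ := ih (insert S M) (hM.insert hS hSM)
      ((Nat.mul_le_mul_left k (by omega)).trans hm)
      (fun q hq => hh q (Finset.mem_insert_of_mem hq))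
      (fun q hq => by
        have := hout q (Finset.mem_insert_of_mem hq)
        have := hSq q hq
        simp only [Finset.biUnion_insert, Finset.mem_union, id]
        tauto)
      (fun q hq r hr => hdis q (Finset.mem_insert_of_mem hq) r (Finset.mem_insert_of_mem hr))
    have hS' : S ⊆ M'.biUnion id := by
      refine Finset.Subset.trans ?_ hsub
      simp [Finset.biUnion_insert]
    refine ⟨M', hM', by omega, Finset.Subset.trans ?_ hsub, fun q hq => ?_⟩
    · rw [Finset.biUnion_insert]; exact Finset.subset_union_right
    · rcases Finset.mem_insert.1 hq with rfl | hq
      · exact ⟨hS' h1S, hS' h2S⟩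
      · exact hcov q hq

/-! ### Perfect matchings in families with small missing degrees -/

/-- The `k`-sets missing from `F`. -/
def missing {n : ℕ} (k : ℕ) (F : Finset (Finset (Fin n))) : Finset (Finset (Fin n)) :=
  Finset.univ.powersetCard k \ F

theorem mem_missing {n k : ℕ} {F : Finset (Finset (Fin n))} {S : Finset (Fin n)} :
    S ∈ missing k F ↔ S.card = k ∧ S ∉ F := by
  simp [missing]

/-- Augmentation: `k` uncovered vertices `u 0, …, u (k - 1)` and more than enough edges of a
matching `M` allow `k - 1` edges of `M` to be exchanged for `k` edges. -/
theorem exists_larger_matching {n k d : ℕ} {F : Finset (Finset (Fin n))} (hk : 1 ≤ k)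
    (hF : ∀ S ∈ F, S.card = k) {W : Finset (Fin n)} {M : Finset (Finset (Fin n))}
    (hM : IsMatchingIn F M) (hMW : M.biUnion id ⊆ W) (hU : k ≤ (W \ M.biUnion id).card)
    (hd : ∀ w ∈ W, ((missing k F).filter (w ∈ ·)).card ≤ d)
    (hlt : k * d < M.card.choose (k - 1)) :
    ∃ M', IsMatchingIn F M' ∧ M'.biUnion id ⊆ W ∧ M.card < M'.card := by
  obtain ⟨U, hUs, hUc⟩ := Finset.exists_subset_card_eq hU
  have hUW : ∀ i, U.orderEmbOfFin hUc i ∈ W ∧ U.orderEmbOfFin hUc i ∉ M.biUnion id := fun i =>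
    Finset.mem_sdiff.1 (hUs (Finset.orderEmbOfFin_mem U hUc i))
  set u : Fin k → Fin n := ⇑(U.orderEmbOfFin hUc) with hu
  have hu_inj : Function.Injective u := (U.orderEmbOfFin hUc).injective
  -- `e S i` is the `i`-th vertex of the edge `S`
  have henum : ∃ e : Finset (Fin n) → Fin k → Fin n, ∀ S ∈ M, Function.Injective (e S) ∧
      ∀ i, e S i ∈ S := by
    have : ∀ S, ∃ f : Fin k → Fin n, S ∈ M → Function.Injective f ∧ ∀ i, f i ∈ S := by
      intro S
      by_cases hS : S ∈ M
      · have hc := hF S (hM.1 hS)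
        exact ⟨S.orderEmbOfFin hc, fun _ =>
          ⟨(S.orderEmbOfFin hc).injective, fun i => Finset.orderEmbOfFin_mem S hc i⟩⟩
      · exact ⟨u, fun h => absurd h hS⟩
    choose e he using this
    exact ⟨e, fun S hS => he S hS⟩
  obtain ⟨e, he⟩ := henum
  have he_inj : ∀ S ∈ M, ∀ T ∈ M, ∀ i j, e S i = e T j → S = T ∧ i = j := by
    intro S hS T hT i j h
    have hST : S = T := by
      by_contra hne
      exact Finset.disjoint_left.1 (hM.2 S hS T hT hne) ((he S hS).2 i) (h ▸ (he T hT).2 j)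
    subst hST
    exact ⟨rfl, (he S hS).1 h⟩
  have hmemU : ∀ S ∈ M, ∀ i, e S i ∈ M.biUnion id := fun S hS i =>
    Finset.mem_biUnion.2 ⟨S, hS, (he S hS).2 i⟩
  have hune : ∀ S ∈ M, ∀ i j, e S i ≠ u j := fun S hS i j h =>
    (hUW j).2 (h ▸ hmemU S hS i)
  set T : Fin k → Finset (Finset (Fin n)) → Finset (Fin n) :=
    fun i J => insert (u i) (J.image fun S => e S i) with hT
  have hTcard : ∀ i, ∀ J ∈ M.powersetCard (k - 1), (T i J).card = k := by
    intro i J hJ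
    obtain ⟨hJM, hJc⟩ := Finset.mem_powersetCard.1 hJ
    rw [hT]
    simp only
    rw [Finset.card_insert_of_notMem, Finset.card_image_of_injOn, hJc]
    · omega
    · intro S hS S' hS' h
      exact (he_inj S (hJM hS) S' (hJM hS') i i h).1
    · intro h
      obtain ⟨S, hS, h⟩ := Finset.mem_image.1 h
      exact hune S (hJM hS) i i h
  -- a union bound over the `k` transversals
  have hgood : ∃ J ∈ M.powersetCard (k - 1), ∀ i, T i J ∈ F := by
    by_contra! hno
    have hsub : M.powersetCard (k - 1) ⊆
        Finset.univ.biUnion fun i => (M.powersetCard (k - 1)).filter (T i · ∉ F) := by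
      intro J hJ
      obtain ⟨i, hi⟩ := hno J hJ
      exact Finset.mem_biUnion.2 ⟨i, Finset.mem_univ _, Finset.mem_filter.2 ⟨hJ, hi⟩⟩
    have h1 := (Finset.card_le_card hsub).trans
      (Finset.card_biUnion_le_card_mul _ _ d fun i _ => ?_)
    · rw [Finset.card_powersetCard, Finset.card_univ, Fintype.card_fin] at h1
      omega
    · refine le_trans ?_ (hd (u i) (hUW i).1)
      refine Finset.card_le_card_of_injOn (T i) ?_ ?_
      · intro J hJ
        obtain ⟨hJ, hJF⟩ := Finset.mem_filter.1 hJ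
        exact Finset.mem_filter.2
          ⟨mem_missing.2 ⟨hTcard i J hJ, hJF⟩, Finset.mem_insert_self _ _⟩
      · have hrec : ∀ J ∈ (M.powersetCard (k - 1)).filter (T i · ∉ F), ∀ S ∈ M,
            (S ∈ J ↔ e S i ∈ T i J) := by
          intro J hJ S hS
          have hJM := (Finset.mem_powersetCard.1 (Finset.mem_filter.1 hJ).1).1
          constructor
          · intro h
            exact Finset.mem_insert_of_mem (Finset.mem_image_of_mem (fun S => e S i) h)
          · intro h
            rcases Finset.mem_insert.1 h with h | h
            · exact absurd h (hune S hS i i)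
            · obtain ⟨S', hS', h⟩ := Finset.mem_image.1 h
              rwa [← (he_inj S' (hJM hS') S hS i i h).1]
        intro J hJ J' hJ' h
        have hJM := (Finset.mem_powersetCard.1 (Finset.mem_filter.1 hJ).1).1
        have hJM' := (Finset.mem_powersetCard.1 (Finset.mem_filter.1 hJ').1).1
        ext S
        constructor
        · intro hS
          rw [hrec J' hJ' S (hJM hS), ← h]
          exact (hrec J hJ S (hJM hS)).1 hS
        · intro hS
          rw [hrec J hJ S (hJM' hS), h]
          exact (hrec J' hJ' S (hJM' hS)).1 hS
  obtain ⟨J, hJ, hJF⟩ := hgood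
  obtain ⟨hJM, hJc⟩ := Finset.mem_powersetCard.1 hJ
  have hTmem : ∀ i, ∀ x ∈ T i J, x = u i ∨ ∃ S ∈ J, x = e S i := by
    intro i x hx
    rcases Finset.mem_insert.1 hx with h | h
    · exact Or.inl h
    · obtain ⟨S, hS, h⟩ := Finset.mem_image.1 h
      exact Or.inr ⟨S, hS, h.symm⟩
  have hTT : ∀ i j, i ≠ j → Disjoint (T i J) (T j J) := by
    intro i j hij
    rw [Finset.disjoint_left]
    intro x hx hx'
    rcases hTmem i x hx with h | ⟨S, hS, h⟩ <;> rcases hTmem j x hx' with h' | ⟨S', hS', h'⟩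
    · exact hij (hu_inj (h.symm.trans h'))
    · exact hune S' (hJM hS') j i (h'.symm.trans h)
    · exact hune S (hJM hS) i j (h.symm.trans h')
    · exact hij (he_inj S (hJM hS) S' (hJM hS') i j (h.symm.trans h')).2
  have hTM : ∀ i, ∀ S ∈ M \ J, Disjoint (T i J) S := by
    intro i S hS
    obtain ⟨hS, hSJ⟩ := Finset.mem_sdiff.1 hS
    rw [Finset.disjoint_left]
    intro x hx hxS
    rcases hTmem i x hx with h | ⟨S', hS', h⟩
    · exact (hUW i).2 (h ▸ Finset.mem_biUnion.2 ⟨S, hS, hxS⟩)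
    · have hne : S' ≠ S := fun h => hSJ (h ▸ hS')
      exact Finset.disjoint_left.1 (hM.2 S' (hJM hS') S hS hne)
        ((he S' (hJM hS')).2 i) (h ▸ hxS)
  refine ⟨(M \ J) ∪ Finset.univ.image fun i => T i J, ⟨?_, ?_⟩, ?_, ?_⟩
  · refine Finset.union_subset (Finset.sdiff_subset.trans hM.1) ?_
    intro S hS
    obtain ⟨i, -, rfl⟩ := Finset.mem_image.1 hS
    exact hJF i
  · intro S hS S' hS' hne
    rcases Finset.mem_union.1 hS with h | h <;> rcases Finset.mem_union.1 hS' with h' | h'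
    · exact hM.2 S (Finset.mem_sdiff.1 h).1 S' (Finset.mem_sdiff.1 h').1 hne
    · obtain ⟨i, -, rfl⟩ := Finset.mem_image.1 h'
      exact (hTM i S h).symm
    · obtain ⟨i, -, rfl⟩ := Finset.mem_image.1 h
      exact hTM i S' h'
    · obtain ⟨i, -, rfl⟩ := Finset.mem_image.1 h
      obtain ⟨j, -, rfl⟩ := Finset.mem_image.1 h'
      exact hTT i j fun h => hne (by rw [h])
  · refine Finset.biUnion_subset.2 fun S hS => ?_
    rcases Finset.mem_union.1 hS with h | h
    · exact (Finset.subset_biUnion_of_mem id (Finset.mem_sdiff.1 h).1).trans hMW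
    · obtain ⟨i, -, rfl⟩ := Finset.mem_image.1 h
      intro x hx
      rcases hTmem i x hx with h | ⟨S', hS', h⟩
      · exact h ▸ (hUW i).1
      · exact hMW (h ▸ hmemU S' (hJM hS') i)
  · rw [Finset.card_union_of_disjoint, Finset.card_sdiff_of_subset hJM, hJc,
      Finset.card_image_of_injective, Finset.card_univ, Fintype.card_fin]
    · have := Finset.card_le_card hJM
      omega
    · intro i j hij
      by_contra hne
      have h1 := hTT i j hne
      simp only at hij
      rw [← hij, disjoint_self] at h1
      exact Finset.insert_ne_empty _ _ h1
    · rw [Finset.disjoint_left]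
      intro S hS hS'
      obtain ⟨i, -, rfl⟩ := Finset.mem_image.1 hS'
      have h1 := hTM i _ hS
      rw [disjoint_self] at h1
      exact Finset.insert_ne_empty _ _ h1

/-- A family that misses few `k`-sets at each vertex of `W` has a perfect matching on `W`. -/
theorem exists_matching_of_small_missing_degree {n k d t : ℕ} {F : Finset (Finset (Fin n))}
    (hk : 2 ≤ k) (hF : ∀ S ∈ F, S.card = k) {W : Finset (Fin n)} (hW : W.card = k * t)
    (hd : ∀ w ∈ W, ((missing k F).filter (w ∈ ·)).card ≤ d)
    (hlt : k * d < (t / 2).choose (k - 1)) :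
    ∃ M, IsMatchingIn F M ∧ M.biUnion id = W := by
  classical
  obtain ⟨M, hM, hmax⟩ := Finset.exists_max_image
    (F.powerset.filter fun M => IsMatchingIn F M ∧ M.biUnion id ⊆ W) Finset.card
    ⟨∅, by simp [IsMatchingIn]⟩
  obtain ⟨-, hM, hMW⟩ := Finset.mem_filter.1 hM
  have hmax' : ∀ M', IsMatchingIn F M' → M'.biUnion id ⊆ W → M'.card ≤ M.card := fun M' h h' =>
    hmax M' (Finset.mem_filter.2 ⟨Finset.mem_powerset.2 h.1, h, h'⟩)
  refine ⟨M, hM, ?_⟩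
  have hMc := card_biUnion_matching hF hM
  rcases Nat.lt_or_ge M.card t with hmt | hmt
  swap
  · refine Finset.eq_of_subset_of_card_le hMW ?_
    rw [hMc, hW]
    exact Nat.mul_le_mul_left k hmt
  exfalso
  have hUc : (W \ M.biUnion id).card = k * (t - M.card) := by
    rw [Finset.card_sdiff_of_subset hMW, hMc, hW, Nat.mul_sub]
  have hkU : k ≤ (W \ M.biUnion id).card := by
    rw [hUc]
    exact Nat.le_mul_of_pos_right k (by omega)
  rcases Nat.lt_or_ge M.card (t / 2) with hsmall | hlarge
  · -- every `k`-set of uncovered vertices is missing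
    obtain ⟨w, hw⟩ := Finset.card_pos.1 (show 0 < (W \ M.biUnion id).card by omega)
    have h1 : (((W \ M.biUnion id).erase w).powersetCard (k - 1)).card ≤
        ((missing k F).filter (w ∈ ·)).card := by
      refine Finset.card_le_card_of_injOn (insert w) ?_ ?_
      · intro S hS
        obtain ⟨hS, hSc⟩ := Finset.mem_powersetCard.1 hS
        have hwS : w ∉ S := fun h => Finset.notMem_erase w _ (hS h)
        have hsub : insert w S ⊆ W \ M.biUnion id :=
          Finset.insert_subset hw (hS.trans (Finset.erase_subset _ _))
        refine Finset.mem_filter.2 ⟨mem_missing.2 ⟨?_, fun hSF => ?_⟩, Finset.mem_insert_self _ _⟩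
        · rw [Finset.card_insert_of_notMem hwS, hSc]
          omega
        · have hdis : Disjoint (insert w S) (M.biUnion id) :=
            Disjoint.mono_left hsub Finset.sdiff_disjoint
          have h2 := hmax' _ (hM.insert hSF hdis) (by
            rw [Finset.biUnion_insert]
            exact Finset.union_subset (hsub.trans Finset.sdiff_subset) hMW)
          rw [Finset.card_insert_of_notMem] at h2
          · omega
          · intro h
            exact Finset.disjoint_left.1 hdis (Finset.mem_insert_self w S)
              (Finset.mem_biUnion.2 ⟨_, h, Finset.mem_insert_self w S⟩)
      · intro S hS S' hS' h
        have hwS : w ∉ S := fun h => Finset.notMem_erase w _ ((Finset.mem_powersetCard.1 hS).1 h)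
        have hwS' : w ∉ S' := fun h => Finset.notMem_erase w _ ((Finset.mem_powersetCard.1 hS').1 h)
        rw [← Finset.erase_insert hwS, ← Finset.erase_insert hwS']
        exact congrArg (Finset.erase · w) h
    have h2 := hd w (Finset.mem_sdiff.1 hw).1
    rw [Finset.card_powersetCard, Finset.card_erase_of_mem hw, hUc] at h1
    have h3 : t / 2 ≤ k * (t - M.card) - 1 := by
      have : 2 * (t - M.card) ≤ k * (t - M.card) := Nat.mul_le_mul_right _ hk
      omega
    have h4 := Nat.choose_le_choose (k - 1) h3
    have h5 : d ≤ k * d := Nat.le_mul_of_pos_left d (by omega)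
    omega
  · obtain ⟨M', hM', hMW', hlt'⟩ := exists_larger_matching (by omega) hF hM hMW hkU hd
      (hlt.trans_le (Nat.choose_le_choose _ hlarge))
    exact absurd (hmax' M' hM' hMW') (by omega)

/-! ### The extremal family -/

theorem mem_franklPart {n k b : ℕ} {E : Fin (b - 1) → Finset (Fin n)} {i : Fin n}
    {S : Finset (Fin n)} : S ∈ franklPart k b E i ↔
      (∃ j : Fin (b - 1), j.val = i.val ∧ S = insert i (E j)) ∨
      (S.card = k ∧ i ∈ S ∧ (∀ v ∈ S, i ≤ v) ∧
        ∃ j : Fin (b - 1), j.val < i.val ∧ ¬ Disjoint S (E j)) := by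
  rw [franklPart, Finset.mem_filter]
  exact and_iff_right (Finset.mem_univ _)

theorem mem_franklFamily {n k b : ℕ} {E : Fin (b - 1) → Finset (Fin n)} {S : Finset (Fin n)} :
    S ∈ franklFamily k b E ↔ (S.card = k ∧ ∀ v ∈ S, b ≤ v.val) ∨
      ∃ i : Fin n, i.val < b ∧ S ∈ franklPart k b E i := by
  rw [franklFamily, Finset.mem_union, Finset.mem_filter, Finset.mem_biUnion]
  simp

theorem IsBaseSystem.card_insert {n k b : ℕ} {E : Fin (b - 1) → Finset (Fin n)}
    (hE : IsBaseSystem k b E) (hk : 1 ≤ k) {i : Fin n} (hi : i.val < b) (j : Fin (b - 1)) :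
    (insert i (E j)).card = k := by
  rw [Finset.card_insert_of_notMem fun h => (hE.2.1 j i h).not_gt hi, hE.1 j]
  omega

theorem card_of_mem_franklFamily {n k b : ℕ} {E : Fin (b - 1) → Finset (Fin n)}
    (hE : IsBaseSystem k b E) (hk : 1 ≤ k) {S : Finset (Fin n)} (hS : S ∈ franklFamily k b E) :
    S.card = k := by
  rcases mem_franklFamily.1 hS with h | ⟨i, hi, h⟩
  · exact h.1
  · rcases mem_franklPart.1 h with ⟨j, -, rfl⟩ | h
    · exact hE.card_insert hk hi j
    · exact h.1

/-- The vertices of `[b]` cannot all be covered: the edges at `1, 2, …` are forced one after the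
other, and the last vertex is left without an edge. -/
theorem franklFamily_not_hasPerfectMatching {n k b : ℕ} {E : Fin (b - 1) → Finset (Fin n)}
    (hE : IsBaseSystem k b E) (hb : 1 ≤ b) (hbn : b ≤ n) :
    ¬ HasPerfectMatching (franklFamily k b E) := by
  rintro ⟨M, hM, hcov⟩
  have key : ∀ m (i : Fin n), i.val = m → m < b →
      ∃ j : Fin (b - 1), j.val = m ∧ insert i (E j) ∈ M := by
    intro m
    induction m using Nat.strong_induction_on with
    | _ m ih =>
      rintro i rfl hib
      obtain ⟨S, hSM, hiS⟩ := hcov i (Finset.mem_univ i)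
      rcases mem_franklFamily.1 (hM.1 hSM) with h | ⟨i', hi', h⟩
      · exact absurd (h.2 i hiS) (by omega)
      rcases mem_franklPart.1 h with ⟨j, hj, rfl⟩ | ⟨-, hi'S, hmin, j, hj, hdis⟩
      · rcases Finset.mem_insert.1 hiS with rfl | h
        · exact ⟨j, hj, hSM⟩
        · exact absurd (hE.2.1 j i h) (by omega)
      · have hii' : i'.val ≤ i.val := hmin i hiS
        obtain ⟨j', hj', hmem⟩ := ih j.val (by omega) ⟨j.val, by omega⟩ rfl (by omega)
        obtain rfl : j' = j := Fin.ext hj'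
        have hS : S = insert (⟨j'.val, by omega⟩ : Fin n) (E j') := by
          by_contra hne
          exact hdis ((hM.2 S hSM _ hmem hne).mono_right (Finset.subset_insert _ _))
        rw [hS] at hiS
        rcases Finset.mem_insert.1 hiS with h | h
        · rw [Fin.ext_iff] at h
          simp only at h
          omega
        · exact absurd (hE.2.1 j' i h) (by omega)
  obtain ⟨j, hj, -⟩ := key (b - 1) ⟨b - 1, by omega⟩ rfl (by omega)
  exact absurd j.isLt (by omega)

/-- A matching extends vertex by vertex as long as the family contains all `k`-sets that avoid a
fixed small set `Z`. -/
theorem exists_matching_extending {n k : ℕ} {F : Finset (Finset (Fin n))} (hk : 1 ≤ k)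
    (hF : ∀ S ∈ F, S.card = k) {Z : Finset (Fin n)}
    (hZ : ∀ S : Finset (Fin n), S.card = k → Disjoint S Z → S ∈ F) (R : Finset (Fin n)) :
    ∀ M, IsMatchingIn F M → Disjoint R Z → Z.card + k * (M.card + R.card) ≤ n →
      ∃ M', IsMatchingIn F M' ∧ M'.card = M.card + R.card ∧ M.biUnion id ⊆ M'.biUnion id ∧
        R ⊆ M'.biUnion id := by
  induction R using Finset.induction_on with
  | empty => exact fun M hM _ _ => ⟨M, hM, by simp, subset_rfl, by simp⟩
  | insert r R hr ih =>
    intro M hM hRZ hn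
    rw [Finset.card_insert_of_notMem hr] at hn ⊢
    rw [Finset.disjoint_insert_left] at hRZ
    have hUc : k ≤ (Finset.univ \ (Z ∪ M.biUnion id)).card := by
      rw [Finset.card_sdiff_of_subset (Finset.subset_univ _), Finset.card_univ, Fintype.card_fin]
      have h1 := Finset.card_union_le Z (M.biUnion id)
      have h2 := card_biUnion_matching_le hF hM
      have h3 : k * (M.card + (R.card + 1)) = k * M.card + k * R.card + k := by ring
      omega
    have hS : ∃ S : Finset (Fin n), S.card = k ∧ S ⊆ Finset.univ \ (Z ∪ M.biUnion id) ∧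
        (r ∉ M.biUnion id → r ∈ S) := by
      by_cases hrM : r ∈ M.biUnion id
      · obtain ⟨S, hS, hSc⟩ := Finset.exists_subset_card_eq hUc
        exact ⟨S, hSc, hS, fun h => absurd hrM h⟩
      · obtain ⟨S, hrS, hS, hSc⟩ := Finset.exists_subsuperset_card_eq (s := {r}) (n := k)
          (Finset.singleton_subset_iff.2 (show r ∈ Finset.univ \ (Z ∪ M.biUnion id) by
            rw [Finset.mem_sdiff, Finset.mem_union, not_or]
            exact ⟨Finset.mem_univ r, hRZ.1, hrM⟩)) (by simpa using hk) hUc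
        exact ⟨S, hSc, hS, fun _ => hrS (Finset.mem_singleton_self r)⟩
    obtain ⟨S, hSc, hS, hrS⟩ := hS
    have hdis : Disjoint S (Z ∪ M.biUnion id) := Disjoint.mono_left hS Finset.sdiff_disjoint
    have hSM := hdis.mono_right (Finset.subset_union_right (s₁ := Z))
    have hSnot : S ∉ M := by
      intro h
      obtain ⟨x, hx⟩ := Finset.card_pos.1 (show 0 < S.card by omega)
      exact Finset.disjoint_left.1 hSM hx (Finset.mem_biUnion.2 ⟨S, h, hx⟩)
    obtain ⟨M', hM', hc, hsub, hR⟩ := ih (insert S M)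
      (hM.insert (hZ S hSc (hdis.mono_right Finset.subset_union_left)) hSM) hRZ.2
      (by rw [Finset.card_insert_of_notMem hSnot]; exact le_of_eq_of_le (by ring) hn)
    rw [Finset.card_insert_of_notMem hSnot] at hc
    rw [Finset.biUnion_insert] at hsub
    refine ⟨M', hM', by omega, Finset.union_subset_right hsub, Finset.insert_subset ?_ hR⟩
    by_cases hrM : r ∈ M.biUnion id
    · exact hsub (Finset.mem_union_right _ hrM)
    · exact hsub (Finset.mem_union_left _ (hrS hrM))

/-- If `i₀ ∈ [b]` is not to be covered, the last vertex of `[b]` can use the set `E_{i₀}`, and every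
other vertex `i` of `[b]` uses its own set `E_i`. -/
theorem franklFamily_not_isBlockingSet {n k s b : ℕ} {E : Fin (b - 1) → Finset (Fin n)}
    (hE : IsBaseSystem k b E) (hk : 2 ≤ k) (hn : b + k * b ≤ n) {B : Finset (Fin n)}
    (hB : B.card < b) : ¬ IsBlockingSet s (franklFamily k b E) B := by
  rintro ⟨-, hno⟩
  apply hno
  set Z : Finset (Fin n) := Finset.univ.filter fun i => i.val < b with hZdef
  have hmemZ : ∀ i, i ∈ Z ↔ i.val < b := fun i => by simp [hZdef]
  have hZc : Z.card = b := by
    rw [hZdef, Fin.card_filter_val_lt]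
    exact min_eq_right (by omega)
  obtain ⟨i₀, hi₀, hi₀B⟩ : ∃ i₀ ∈ Z, i₀ ∉ B := by
    by_contra! h
    have := Finset.card_le_card (show Z ⊆ B from h)
    omega
  have hi₀b := (hmemZ i₀).1 hi₀
  -- the vertex `i` is covered by `{i} ∪ E (φ i)`
  have hφ : ∃ φ : Fin n → Fin n, (∀ i ∈ B ∩ Z, (φ i).val < b - 1 ∧
      (φ i = i ∨ (i.val = b - 1 ∧ φ i = i₀ ∧ i₀.val < b - 1))) := by
    refine ⟨fun i => if i.val < b - 1 then i else i₀, fun i hi => ?_⟩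
    obtain ⟨hiB, hiZ⟩ := Finset.mem_inter.1 hi
    have hne : i.val ≠ i₀.val := fun h => hi₀B (Fin.ext h ▸ hiB)
    have := (hmemZ i).1 hiZ
    by_cases h : i.val < b - 1
    · simp only [if_pos h]
      exact ⟨h, Or.inl trivial⟩
    · simp only [if_neg h]
      exact ⟨by omega, Or.inr ⟨by omega, trivial, by omega⟩⟩
  obtain ⟨φ, hφ⟩ := hφ
  have hφ_inj : ∀ i ∈ B ∩ Z, ∀ j ∈ B ∩ Z, i ≠ j → φ i ≠ φ j := by
    intro i hi j hj hij h
    have hiB := (Finset.mem_inter.1 hi).1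
    have hjB := (Finset.mem_inter.1 hj).1
    rcases (hφ i hi).2 with h1 | ⟨h1, h1', -⟩ <;> rcases (hφ j hj).2 with h2 | ⟨h2, h2', -⟩
    · exact hij (h1.symm.trans (h.trans h2))
    · exact hi₀B (by rwa [← h2', ← h, h1])
    · exact hi₀B (by rwa [← h1', h, h2])
    · exact hij (Fin.ext (h1.trans h2.symm))
  set M : Finset (Finset (Fin n)) := (B ∩ Z).attach.image fun i =>
    insert i.1 (E ⟨(φ i.1).val, (hφ i.1 i.2).1⟩) with hMdef
  have hMF : M ⊆ franklFamily k b E := by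
    intro S hS
    obtain ⟨⟨i, hi⟩, -, rfl⟩ := Finset.mem_image.1 hS
    have hib := (hmemZ i).1 (Finset.mem_inter.1 hi).2
    refine mem_franklFamily.2 (Or.inr ⟨i, hib, mem_franklPart.2 ?_⟩)
    rcases (hφ i hi).2 with h | ⟨h1, h2, h3⟩
    · exact Or.inl ⟨_, congrArg Fin.val h, rfl⟩
    · refine Or.inr ⟨hE.card_insert (by omega) hib _, Finset.mem_insert_self _ _, ?_,
        ⟨(φ i).val, (hφ i hi).1⟩, ?_, ?_⟩
      · intro v hv
        rcases Finset.mem_insert.1 hv with rfl | hv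
        · exact le_rfl
        · have := hE.2.1 _ v hv
          exact Fin.le_def.2 (by omega)
      · simp only [h2]
        omega
      · intro hdis
        have h4 := hdis.mono_left (Finset.subset_insert _ _)
        rw [disjoint_self] at h4
        have h5 := hE.1 ⟨(φ i).val, (hφ i hi).1⟩
        rw [h4] at h5
        simp at h5
        omega
  have hdisj : ∀ i (hi : i ∈ B ∩ Z) j (hj : j ∈ B ∩ Z), i ≠ j →
      Disjoint (insert i (E ⟨(φ i).val, (hφ i hi).1⟩)) (insert j (E ⟨(φ j).val, (hφ j hj).1⟩)) := by
    intro i hi j hj hij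
    have hib := (hmemZ i).1 (Finset.mem_inter.1 hi).2
    have hjb := (hmemZ j).1 (Finset.mem_inter.1 hj).2
    rw [Finset.disjoint_insert_left, Finset.disjoint_insert_right, Finset.mem_insert, not_or]
    refine ⟨⟨hij, fun h => (hE.2.1 _ i h).not_gt hib⟩, fun h => (hE.2.1 _ j h).not_gt hjb, ?_⟩
    refine hE.2.2 _ _ fun h => hφ_inj i hi j hj hij (Fin.ext ?_)
    simpa using h
  have hM : IsMatchingIn (franklFamily k b E) M := by
    refine ⟨hMF, ?_⟩
    intro S hS T hT hne
    obtain ⟨⟨i, hi⟩, -, rfl⟩ := Finset.mem_image.1 hS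
    obtain ⟨⟨j, hj⟩, -, rfl⟩ := Finset.mem_image.1 hT
    refine hdisj i hi j hj fun h => hne ?_
    subst h
    rfl
  have hMc : M.card = (B ∩ Z).card := by
    rw [hMdef, Finset.card_image_of_injective, Finset.card_attach]
    rintro ⟨i, hi⟩ ⟨j, hj⟩ h
    by_contra hne
    have h1 := hdisj i hi j hj fun h => hne (Subtype.ext h)
    simp only at h
    rw [← h, disjoint_self] at h1
    exact Finset.insert_ne_empty _ _ h1
  have hBc : (B ∩ Z).card + (B \ Z).card = B.card := by
    rw [add_comm, Finset.card_sdiff_add_card_inter]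
  obtain ⟨M', hM', hc, hsub, hR⟩ := exists_matching_extending (k := k) (by omega)
    (fun S hS => card_of_mem_franklFamily hE (by omega) hS) (Z := Z)
    (fun S hSc hSZ => mem_franklFamily.2 (Or.inl ⟨hSc, fun v hv => by
      by_contra h
      exact Finset.disjoint_left.1 hSZ hv ((hmemZ v).2 (by omega))⟩))
    (B \ Z) M hM Finset.sdiff_disjoint (by
      rw [hMc, hZc, hBc]
      exact (Nat.add_le_add_left (Nat.mul_le_mul_left k hB.le) b).trans hn)
  refine ⟨M', hM', by omega, covers_iff_subset.2 fun v hv => ?_⟩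
  by_cases hvZ : v ∈ Z
  · refine hsub (Finset.mem_biUnion.2 ⟨_, Finset.mem_image.2
      ⟨⟨v, Finset.mem_inter.2 ⟨hv, hvZ⟩⟩, Finset.mem_attach _ _, rfl⟩, Finset.mem_insert_self _ _⟩)
  · exact hR (Finset.mem_sdiff.2 ⟨hv, hvZ⟩)

theorem franklFamily_isAdmissible {n k s b : ℕ} {E : Fin (b - 1) → Finset (Fin n)}
    (hE : IsBaseSystem k b E) (hk : 2 ≤ k) (hb : 1 ≤ b) (hn : b + k * b ≤ n) :
    IsAdmissible k s b (franklFamily k b E) :=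
  ⟨fun _ => card_of_mem_franklFamily hE (by omega),
    franklFamily_not_hasPerfectMatching hE hb (by omega),
    fun _ hB => franklFamily_not_isBlockingSet hE hk hn hB⟩

/-- Lower bound for the size of the extremal family: besides the `k`-sets that avoid `[b]`, it
counts the sets containing some `i ∈ [b]`, exactly one vertex of `E_1 ∪ ⋯ ∪ E_{i-1}`, and no
further vertex of `[b]` or of the sets `E_j`. -/
theorem le_card_franklFamily {n k b : ℕ} {E : Fin (b - 1) → Finset (Fin n)}
    (hE : IsBaseSystem k b E) (hk : 2 ≤ k) (hb : 1 ≤ b) (hbn : b ≤ n) :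
    (n - b).choose k + (k - 1) * b.choose 2 * (n - b * k).choose (k - 2) ≤
      (franklFamily k b E).card := by
  set Z : Finset (Fin n) := Finset.univ.filter fun i => i.val < b with hZdef
  have hmemZ : ∀ i, i ∈ Z ↔ i.val < b := fun i => by simp [hZdef]
  have hZc : Z.card = b := by
    rw [hZdef, Fin.card_filter_val_lt]
    exact min_eq_right (by omega)
  set X : Finset (Fin n) := Finset.univ.biUnion E with hX
  have hXb : ∀ x ∈ X, b ≤ x.val := by
    intro x hx
    obtain ⟨j, -, hj⟩ := Finset.mem_biUnion.1 hx
    exact hE.2.1 j x hj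
  set Y : Finset (Fin n) := Finset.univ \ (Z ∪ X) with hY
  have hXc : X.card ≤ (b - 1) * (k - 1) := by
    have := Finset.card_biUnion_le_card_mul Finset.univ E (k - 1) (fun j _ => (hE.1 j).le)
    simpa using this
  have hYc : n - b * k ≤ Y.card := by
    rw [hY, Finset.card_sdiff_of_subset (Finset.subset_univ _), Finset.card_univ, Fintype.card_fin]
    have h1 := Finset.card_union_le Z X
    have h2 : b + (b - 1) * (k - 1) ≤ b * k := by
      obtain ⟨b, rfl⟩ : ∃ c, b = c + 1 := ⟨b - 1, by omega⟩
      obtain ⟨k, rfl⟩ : ∃ c, k = c + 1 := ⟨k - 1, by omega⟩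
      simp only [Nat.add_sub_cancel]
      nlinarith
    omega
  -- the vertices of the sets `E_j` with `j` below `i`
  set D : Fin n → Finset (Fin n) := fun i =>
    (Finset.univ.filter fun j : Fin (b - 1) => j.val < i.val).biUnion E with hD
  have hDc : ∀ i ∈ Z, (D i).card = (k - 1) * i.val := by
    intro i hi
    have hi := (hmemZ i).1 hi
    rw [hD]
    simp only
    rw [Finset.card_biUnion (fun x _ y _ h => hE.2.2 x y h),
      Finset.sum_const_nat (fun j _ => hE.1 j), Fin.card_filter_val_lt,
      min_eq_right (by omega), mul_comm]
  have hDX : ∀ i, D i ⊆ X := fun i => Finset.biUnion_subset_biUnion_of_subset_left _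
    (Finset.filter_subset _ _)
  have hZX : ∀ i ∈ Z, i ∉ X := fun i hi h => (hXb i h).not_gt ((hmemZ i).1 hi)
  set I : Finset (Σ _ : Fin n, Fin n × Finset (Fin n)) :=
    Z.sigma fun i => D i ×ˢ Y.powersetCard (k - 2) with hI
  have hIc : I.card = (k - 1) * b.choose 2 * Y.card.choose (k - 2) := by
    have hsum : ∑ i ∈ Z, i.val = b.choose 2 := by
      rw [Nat.choose_two_right, ← Finset.sum_range_id]
      refine Finset.sum_nbij (fun i => i.val) ?_ ?_ ?_ ?_
      · intro i hi
        exact Finset.mem_range.2 ((hmemZ i).1 hi)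
      · exact fun i _ j _ h => Fin.ext h
      · intro m hm
        have hm := Finset.mem_range.1 hm
        exact ⟨⟨m, by omega⟩, (hmemZ _).2 hm, rfl⟩
      · intros; rfl
    rw [hI, Finset.card_sigma]
    simp only [Finset.card_product, Finset.card_powersetCard]
    rw [← Finset.sum_mul, Finset.sum_congr rfl hDc, ← Finset.mul_sum, hsum]
  set f : (Σ _ : Fin n, Fin n × Finset (Fin n)) → Finset (Fin n) :=
    fun p => insert p.1 (insert p.2.1 p.2.2) with hf
  have hmemI : ∀ p ∈ I, p.1 ∈ Z ∧ p.2.1 ∈ D p.1 ∧ p.2.2 ⊆ Y ∧ p.2.2.card = k - 2 := by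
    intro p hp
    obtain ⟨h1, h2⟩ := Finset.mem_sigma.1 hp
    obtain ⟨h3, h4⟩ := Finset.mem_product.1 h2
    exact ⟨h1, h3, Finset.mem_powersetCard.1 h4⟩
  have hmemY : ∀ x ∈ Y, x ∉ Z ∧ x ∉ X := by
    intro x hx
    have := (Finset.mem_sdiff.1 hx).2
    rwa [Finset.mem_union, not_or] at this
  -- the three parts of `f p` are its intersections with `Z`, `X` and `Y`
  have hfZ : ∀ p ∈ I, ∀ x, x ∈ f p ∧ x ∈ Z ↔ x = p.1 := by
    intro p hp x
    obtain ⟨h1, h2, h3, -⟩ := hmemI p hp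
    constructor
    · rintro ⟨hx, hxZ⟩
      rcases Finset.mem_insert.1 hx with h | hx
      · exact h
      rcases Finset.mem_insert.1 hx with h | hx
      · exact absurd (hDX _ h2) (h ▸ hZX x hxZ)
      · exact absurd hxZ (hmemY x (h3 hx)).1
    · rintro rfl
      exact ⟨Finset.mem_insert_self _ _, h1⟩
  have hfX : ∀ p ∈ I, ∀ x, x ∈ f p ∧ x ∈ X ↔ x = p.2.1 := by
    intro p hp x
    obtain ⟨h1, h2, h3, -⟩ := hmemI p hp
    constructor
    · rintro ⟨hx, hxX⟩
      rcases Finset.mem_insert.1 hx with h | hx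
      · exact absurd hxX (h ▸ hZX _ h1)
      rcases Finset.mem_insert.1 hx with h | hx
      · exact h
      · exact absurd hxX (hmemY x (h3 hx)).2
    · rintro rfl
      exact ⟨Finset.mem_insert_of_mem (Finset.mem_insert_self _ _), hDX _ h2⟩
  have hfY : ∀ p ∈ I, ∀ x, x ∈ f p ∧ x ∈ Y ↔ x ∈ p.2.2 := by
    intro p hp x
    obtain ⟨h1, h2, h3, -⟩ := hmemI p hp
    constructor
    · rintro ⟨hx, hxY⟩
      rcases Finset.mem_insert.1 hx with h | hx
      · exact absurd h1 (h ▸ (hmemY x hxY).1)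
      rcases Finset.mem_insert.1 hx with h | hx
      · exact absurd (hDX _ h2) (h ▸ (hmemY x hxY).2)
      · exact hx
    · intro hx
      exact ⟨Finset.mem_insert_of_mem (Finset.mem_insert_of_mem hx), h3 hx⟩
  have hfinj : Set.InjOn f I := by
    intro p hp q hq h
    have e1 : p.1 = q.1 := (hfZ q hq _).1 (h ▸ (hfZ p hp _).2 rfl)
    have e2 : p.2.1 = q.2.1 := (hfX q hq _).1 (h ▸ (hfX p hp _).2 rfl)
    have e3 : p.2.2 = q.2.2 := by
      ext x
      rw [← hfY p hp x, ← hfY q hq x, h]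
    obtain ⟨p1, p2, p3⟩ := p
    obtain ⟨q1, q2, q3⟩ := q
    simp only at e1 e2 e3
    rw [e1, e2, e3]
  have hZcompl : (Finset.univ \ Z).card = n - b := by
    rw [Finset.card_sdiff_of_subset (Finset.subset_univ _), Finset.card_univ, Fintype.card_fin, hZc]
  have hsub : (Finset.univ \ Z).powersetCard k ∪ I.image f ⊆ franklFamily k b E := by
    refine Finset.union_subset ?_ ?_
    · intro S hS
      obtain ⟨hS, hSc⟩ := Finset.mem_powersetCard.1 hS
      refine mem_franklFamily.2 (Or.inl ⟨hSc, fun v hv => ?_⟩)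
      have := (Finset.mem_sdiff.1 (hS hv)).2
      rw [hmemZ] at this
      omega
    · intro S hS
      obtain ⟨p, hp, rfl⟩ := Finset.mem_image.1 hS
      obtain ⟨h1, h2, h3, h4⟩ := hmemI p hp
      obtain ⟨j, hj, hxj⟩ := Finset.mem_biUnion.1 h2
      refine mem_franklFamily.2 (Or.inr ⟨p.1, (hmemZ _).1 h1, mem_franklPart.2 (Or.inr
        ⟨?_, Finset.mem_insert_self _ _, ?_, j, (Finset.mem_filter.1 hj).2, ?_⟩)⟩)
      · have n1 : p.2.1 ∉ p.2.2 := fun h => (hmemY _ (h3 h)).2 (hDX _ h2)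
        have n2 : p.1 ∉ insert p.2.1 p.2.2 := by
          rw [Finset.mem_insert, not_or]
          exact ⟨fun h => hZX _ h1 (h ▸ hDX _ h2), fun h => (hmemY _ (h3 h)).1 h1⟩
        rw [hf]
        simp only
        rw [Finset.card_insert_of_notMem n2, Finset.card_insert_of_notMem n1, h4]
        omega
      · intro v hv
        by_cases hvZ : v ∈ Z
        · exact ((hfZ p hp v).1 ⟨hv, hvZ⟩).ge
        · rw [hmemZ] at hvZ
          have := (hmemZ _).1 h1
          exact Fin.le_def.2 (by omega)
      · exact Finset.not_disjoint_iff.2 ⟨p.2.1, ((hfX p hp _).2 rfl).1, hxj⟩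
  have hdis : Disjoint ((Finset.univ \ Z).powersetCard k) (I.image f) := by
    rw [Finset.disjoint_left]
    intro S hS hS'
    obtain ⟨p, hp, rfl⟩ := Finset.mem_image.1 hS'
    obtain ⟨h5, h6⟩ := (hfZ p hp p.1).2 rfl
    exact (Finset.mem_sdiff.1 ((Finset.mem_powersetCard.1 hS).1 h5)).2 h6
  calc _ ≤ (n - b).choose k + (k - 1) * b.choose 2 * Y.card.choose (k - 2) :=
        Nat.add_le_add_left (Nat.mul_le_mul_left _ (Nat.choose_le_choose _ hYc)) _
    _ = ((Finset.univ \ Z).powersetCard k ∪ I.image f).card := by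
        rw [Finset.card_union_of_disjoint hdis, Finset.card_powersetCard, hZcompl,
          Finset.card_image_of_injOn hfinj, hIc]
    _ ≤ _ := Finset.card_le_card hsub

/-! ### Minimal uncoverable sets -/

/-- `C` is covered by a matching in `F` of size at most `|C|`. -/
def Coverable {n : ℕ} (F : Finset (Finset (Fin n))) (C : Finset (Fin n)) : Prop :=
  ∃ M, IsMatchingIn F M ∧ M.card ≤ C.card ∧ C ⊆ M.biUnion id

/-- In a minimal uncoverable set `B`, the edges at a vertex `v` all meet the matching that covers
the rest of `B`. -/
theorem exists_transversal_of_minimal {n k : ℕ} {F : Finset (Finset (Fin n))}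
    (hF : ∀ S ∈ F, S.card = k) {B : Finset (Fin n)} (hB : ¬ Coverable F B)
    (hmin : ∀ C ⊂ B, Coverable F C) {v : Fin n} (hv : v ∈ B) :
    ∃ Y : Finset (Fin n), v ∉ Y ∧ Y.card ≤ k * (B.card - 1) ∧ ∀ S ∈ F, v ∈ S → ¬ Disjoint S Y := by
  obtain ⟨M, hM, hc, hcov⟩ := hmin _ (Finset.erase_ssubset hv)
  rw [Finset.card_erase_of_mem hv] at hc
  have hpos : 0 < B.card := Finset.card_pos.2 ⟨v, hv⟩
  refine ⟨M.biUnion id, fun h => hB ⟨M, hM, by omega, ?_⟩,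
    (card_biUnion_matching_le hF hM).trans (Nat.mul_le_mul_left k hc),
    fun S hS hvS hdis => hB ⟨insert S M, hM.insert hS hdis, ?_, ?_⟩⟩
  · rw [← Finset.insert_erase hv]
    exact Finset.insert_subset h hcov
  · have := Finset.card_insert_le S M
    omega
  · rw [← Finset.insert_erase hv, Finset.biUnion_insert]
    exact Finset.insert_subset (Finset.mem_union_left _ hvS)
      (hcov.trans Finset.subset_union_right)

theorem card_filter_mem_mem_le {n k : ℕ} {F : Finset (Finset (Fin n))}
    (hF : ∀ S ∈ F, S.card = k) {v x : Fin n} (hvx : v ≠ x) :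
    (F.filter ({v, x} ⊆ ·)).card ≤ (n - 2).choose (k - 2) := by
  simpa [Finset.card_pair hvx] using card_filter_superset_le F hF {v, x}

theorem degree_le_of_transversal {n k : ℕ} {F : Finset (Finset (Fin n))}
    (hF : ∀ S ∈ F, S.card = k) {v : Fin n} {Y : Finset (Fin n)} (hvY : v ∉ Y)
    (hY : ∀ S ∈ F, v ∈ S → ¬ Disjoint S Y) :
    (F.filter (v ∈ ·)).card ≤ Y.card * (n - 2).choose (k - 2) := by
  have hsub : F.filter (v ∈ ·) ⊆ Y.biUnion fun y => F.filter ({v, y} ⊆ ·) := by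
    intro S hS
    obtain ⟨hS, hvS⟩ := Finset.mem_filter.1 hS
    obtain ⟨y, hyS, hyY⟩ := Finset.not_disjoint_iff.1 (hY S hS hvS)
    refine Finset.mem_biUnion.2 ⟨y, hyY, Finset.mem_filter.2 ⟨hS, ?_⟩⟩
    simp [Finset.insert_subset_iff, hvS, hyS]
  refine (Finset.card_le_card hsub).trans (Finset.card_biUnion_le_card_mul _ _ _ fun y hy => ?_)
  exact card_filter_mem_mem_le hF fun h => hvY (h ▸ hy)

/-- Vertices of small degree force many missing sets: for each vertex `v` of a set `B`, count the
`k`-sets that meet `B` in `v` alone. -/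
theorem card_mul_le_card_missing {n k q : ℕ} (hk : 1 ≤ k) {F : Finset (Finset (Fin n))}
    {B : Finset (Fin n)} (hB : ∀ v ∈ B, (F.filter (v ∈ ·)).card ≤ q) :
    B.card * (n - B.card).choose (k - 1) ≤ (missing k F).card + B.card * q := by
  have hv : ∀ v ∈ B, (n - B.card).choose (k - 1) ≤
      ((missing k F).filter (· ∩ B = {v})).card + q := by
    intro v hv
    have h1 : ((Finset.univ \ B).powersetCard (k - 1)).card ≤
        ((missing k F).filter (· ∩ B = {v}) ∪ F.filter (v ∈ ·)).card := by
      have hnot : ∀ S ∈ (Finset.univ \ B).powersetCard (k - 1), v ∉ S := fun S hS h =>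
        (Finset.mem_sdiff.1 ((Finset.mem_powersetCard.1 hS).1 h)).2 hv
      refine Finset.card_le_card_of_injOn (insert v) ?_ ?_
      · intro S hS
        obtain ⟨hSs, hSc⟩ := Finset.mem_powersetCard.1 hS
        have hc : (insert v S).card = k := by
          rw [Finset.card_insert_of_notMem (hnot S hS), hSc]
          omega
        have hi : insert v S ∩ B = {v} := by
          rw [Finset.insert_inter_of_mem hv, Finset.disjoint_iff_inter_eq_empty.1
            (Disjoint.mono_left hSs Finset.sdiff_disjoint)]
          rfl
        by_cases h : insert v S ∈ F
        · exact Finset.mem_union_right _ (Finset.mem_filter.2 ⟨h, Finset.mem_insert_self _ _⟩)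
        · exact Finset.mem_union_left _ (Finset.mem_filter.2 ⟨mem_missing.2 ⟨hc, h⟩, hi⟩)
      · intro S hS S' hS' h
        rw [← Finset.erase_insert (hnot S hS), ← Finset.erase_insert (hnot S' hS')]
        exact congrArg (Finset.erase · v) h
    rw [Finset.card_powersetCard, Finset.card_sdiff_of_subset (Finset.subset_univ _),
      Finset.card_univ, Fintype.card_fin] at h1
    exact h1.trans ((Finset.card_union_le _ _).trans (Nat.add_le_add_left (hB v hv) _))
  have hdis : (B.biUnion fun v => (missing k F).filter (· ∩ B = {v})).card =
      ∑ v ∈ B, ((missing k F).filter (· ∩ B = {v})).card := by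
    refine Finset.card_biUnion fun v _ w _ hvw => ?_
    rw [Function.onFun, Finset.disjoint_left]
    intro S hS hS'
    exact hvw (Finset.singleton_injective
      ((Finset.mem_filter.1 hS).2.symm.trans (Finset.mem_filter.1 hS').2))
  have hle : (B.biUnion fun v => (missing k F).filter (· ∩ B = {v})).card ≤ (missing k F).card :=
    Finset.card_le_card (Finset.biUnion_subset.2 fun v _ => Finset.filter_subset _ _)
  have hsum := Finset.sum_le_sum hv
  rw [Finset.sum_const, Finset.sum_add_distrib, Finset.sum_const, smul_eq_mul, smul_eq_mul] at hsum
  omega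

theorem card_high_missing_degree_mul_le {n k : ℕ} (F : Finset (Finset (Fin n))) (d : ℕ) :
    (Finset.univ.filter fun v => d < ((missing k F).filter (v ∈ ·)).card).card * (d + 1) ≤
      k * (missing k F).card := by
  have h1 : ∑ v : Fin n, ((missing k F).filter (v ∈ ·)).card = (missing k F).card * k := by
    have := Finset.sum_card_bipartiteAbove_eq_sum_card_bipartiteBelow
      (s := (Finset.univ : Finset (Fin n))) (t := missing k F) (fun v S => v ∈ S)
    simp only [Finset.bipartiteAbove, Finset.bipartiteBelow, Finset.filter_univ_mem] at this
    rw [this]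
    exact Finset.sum_const_nat fun S hS => (mem_missing.1 hS).1
  rw [mul_comm k, ← h1, ← smul_eq_mul, ← Finset.sum_const]
  refine (Finset.sum_le_sum fun v hv => ?_).trans
    (Finset.sum_le_sum_of_subset (Finset.filter_subset _ _))
  exact (Finset.mem_filter.1 hv).2

/-- Once the vertices with many missing sets are covered, the rest has a perfect matching. -/
theorem not_coverable_high_missing_degree {n k s d c : ℕ} {F : Finset (Finset (Fin n))}
    (hk : 2 ≤ k) (hn : n = k * s) (hF : ∀ S ∈ F, S.card = k) (hpm : ¬ HasPerfectMatching F)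
    (hlt : k * d < ((s - c) / 2).choose (k - 1)) {D : Finset (Fin n)} (hDc : D.card ≤ c)
    (hD : ∀ v ∉ D, ((missing k F).filter (v ∈ ·)).card ≤ d) : ¬ Coverable F D := by
  rintro ⟨M, hM, hMc, hcov⟩
  have hMu := card_biUnion_matching hF hM
  obtain ⟨M', hM', hM'u⟩ := exists_matching_of_small_missing_degree (t := s - M.card) (d := d) hk hF
    (W := Finset.univ \ M.biUnion id)
    (by rw [Finset.card_sdiff_of_subset (Finset.subset_univ _), Finset.card_univ,
          Fintype.card_fin, hMu, Nat.mul_sub, ← hn])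
    (fun w hw => hD w fun h => (Finset.mem_sdiff.1 hw).2 (hcov h))
    (hlt.trans_le (Nat.choose_le_choose _ (Nat.div_le_div_right (by omega))))
  have hdis : ∀ S ∈ M, ∀ T ∈ M', Disjoint S T := by
    intro S hS T hT
    have hT' : T ⊆ Finset.univ \ M.biUnion id := hM'u ▸ Finset.subset_biUnion_of_mem id hT
    exact (Disjoint.mono_left hT' Finset.sdiff_disjoint).symm.mono_left
      (Finset.subset_biUnion_of_mem id hS)
  refine hpm ⟨M ∪ M', ⟨Finset.union_subset hM.1 hM'.1, ?_⟩, ?_⟩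
  · intro S hS T hT hne
    rcases Finset.mem_union.1 hS with h | h <;> rcases Finset.mem_union.1 hT with h' | h'
    · exact hM.2 S h T h' hne
    · exact hdis S h T h'
    · exact (hdis T h' S h).symm
    · exact hM'.2 S h T h' hne
  · rw [covers_iff_subset, Finset.union_biUnion, hM'u, Finset.union_sdiff_of_subset]
    exact Finset.subset_univ _

/-- An admissible family with few missing sets has an uncoverable set of size exactly `b`. -/
theorem IsAdmissible.exists_minimal_uncoverable {n k s b c d : ℕ} {F : Finset (Finset (Fin n))}
    (hk : 2 ≤ k) (hn : n = k * s) (hbs : b ≤ s) (hF : IsAdmissible k s b F)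
    (hmiss : (missing k F).card ≤ b * (n - 1).choose (k - 1))
    (hc : k * (b * (n - 1).choose (k - 1)) < (c + 1) * (d + 1))
    (hd : k * d < ((s - c) / 2).choose (k - 1))
    (hlarge : b * (n - 1).choose (k - 1) + (b + 1) * (k * c * (n - 2).choose (k - 2)) <
      (b + 1) * (n - (b + 1)).choose (k - 1)) :
    ∃ B : Finset (Fin n), B.card = b ∧ ¬ Coverable F B ∧ ∀ C ⊂ B, Coverable F C := by
  classical
  obtain ⟨hunif, hpm, hblock⟩ := hF
  set D := Finset.univ.filter fun v => d < ((missing k F).filter (v ∈ ·)).card with hD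
  have hDc : D.card ≤ c := by
    have h1 := card_high_missing_degree_mul_le (k := k) F d
    have h2 := h1.trans (Nat.mul_le_mul_left k hmiss)
    exact Nat.lt_succ_iff.1 (Nat.lt_of_mul_lt_mul_right (h2.trans_lt hc))
  have hDnot : ¬ Coverable F D := not_coverable_high_missing_degree hk hn hunif hpm hd hDc
    fun v hv => by simpa [hD] using hv
  obtain ⟨B, hBmem, hBmin⟩ := Finset.exists_min_image
    (D.powerset.filter fun C => ¬ Coverable F C) Finset.card
    ⟨D, Finset.mem_filter.2 ⟨Finset.mem_powerset_self D, hDnot⟩⟩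
  obtain ⟨hBD, hB⟩ := Finset.mem_filter.1 hBmem
  rw [Finset.mem_powerset] at hBD
  have hmin : ∀ C ⊂ B, Coverable F C := by
    intro C hC
    by_contra hno
    have := hBmin C (Finset.mem_filter.2 ⟨Finset.mem_powerset.2 (hC.1.trans hBD), hno⟩)
    exact absurd (Finset.card_lt_card hC) (by omega)
  refine ⟨B, le_antisymm ?_ ?_, hB, hmin⟩
  · -- `b + 1` vertices of small degree would leave too many sets missing
    by_contra! hlt
    obtain ⟨B₀, hB₀, hB₀c⟩ := Finset.exists_subset_card_eq (Nat.succ_le_of_lt hlt)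
    have h1 := card_mul_le_card_missing (F := F) (k := k) (B := B₀)
      (q := k * c * (n - 2).choose (k - 2)) (by omega) (fun v hv => by
        obtain ⟨Y, hvY, hYc, hY⟩ := exists_transversal_of_minimal hunif hB hmin (hB₀ hv)
        refine (degree_le_of_transversal hunif hvY hY).trans (Nat.mul_le_mul_right _ (hYc.trans ?_))
        have := Finset.card_le_card hBD
        exact Nat.mul_le_mul_left k (by omega))
    rw [hB₀c] at h1
    simp only [Nat.succ_eq_add_one] at h1
    omega
  · by_contra! hlt
    refine hblock B hlt ⟨by omega, ?_⟩
    rintro ⟨M, hM, hMc, hcov⟩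
    exact hB ⟨M, hM, hMc.le, covers_iff_subset.1 hcov⟩

/-! ### Counting the edges that meet an uncoverable set -/

/-- The codegree above which a pair counts as heavy: heavy pairs extend to an edge that avoids any
`k * b` further vertices. -/
def lightCodegree (n k b : ℕ) : ℕ := k * b * (n - 3).choose (k - 3)

/-- The members of `F` that meet `C`. -/
def meeting {n : ℕ} (F : Finset (Finset (Fin n))) (C : Finset (Fin n)) : Finset (Finset (Fin n)) :=
  F.filter fun S => ¬ Disjoint S C

/-- The bound for the number of edges that meet `c` vertices of an uncoverable set of size `b`: its
main term comes from `(k - 1) * (0 + 1 + ⋯ + (c - 1))` heavy pairs. -/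
def meetingBound (n k b c : ℕ) : ℕ :=
  (k - 1) * c.choose 2 * (n - 2).choose (k - 2) + c * (k * b * lightCodegree n k b)

theorem choose_two_add (c a : ℕ) : (c + a).choose 2 = c.choose 2 + c * a + a.choose 2 := by
  induction a with
  | zero => simp
  | succ a ih =>
    rw [← add_assoc, Nat.choose_succ_succ' (c + a) 1, Nat.choose_succ_succ' a 1, ih,
      Nat.choose_one_right, Nat.choose_one_right]
    ring

theorem mul_pred_eq_two_mul_choose_two (a : ℕ) : a * (a - 1) = 2 * a.choose 2 := by
  induction a with
  | zero => simp
  | succ a ih =>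
    rw [Nat.choose_succ_succ' a 1, Nat.choose_one_right, mul_add, ← ih]
    rcases a with _ | a
    · simp
    · simp only [Nat.add_sub_cancel]
      ring

section

variable {n k b : ℕ} {F : Finset (Finset (Fin n))} {B : Finset (Fin n)}

/-- Given a matching that covers `C`, some set `A` of vertices of `B` outside the matching has few
heavy neighbours outside the matching. -/
theorem exists_low_degree_outside_matching (hk : 2 ≤ k) (hF : ∀ S ∈ F, S.card = k)
    (hBc : B.card = b) (hB : ¬ Coverable F B) {C : Finset (Fin n)} (hCB : C ⊆ B)
    {M : Finset (Finset (Fin n))} (hM : IsMatchingIn F M) (hMc : M.card ≤ C.card)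
    (hcov : C ⊆ M.biUnion id) :
    ∃ A ⊆ B \ M.biUnion id, A.Nonempty ∧
      ∀ v ∈ A, (heavyNbrs F (lightCodegree n k b) v \ M.biUnion id).card < A.card := by
  by_contra! hno
  obtain ⟨P, hP, hdis, hPcov⟩ := exists_pairing_or_low_degree
    (fun v => heavyNbrs F (lightCodegree n k b) v \ M.biUnion id)
    (fun v h => by simp [heavyNbrs] at h) (B \ M.biUnion id) hno
  have hPc : P.card ≤ (B \ M.biUnion id).card := by
    refine Finset.card_le_card_of_injOn Prod.fst (fun p hp => (hP p hp).1) ?_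
    intro p hp q hq h
    by_contra hne
    exact Finset.disjoint_left.1 (hdis p hp q hq hne) (Finset.mem_insert_self _ _) (by simp [h])
  have hCc : C.card ≤ (B ∩ M.biUnion id).card :=
    Finset.card_le_card (Finset.subset_inter hCB hcov)
  have hsum := Finset.card_sdiff_add_card_inter B (M.biUnion id)
  obtain ⟨M', hM', hc, hsub, hcov'⟩ := exists_matching_of_pairing (m := k * b) hk hF P M hM
    (Nat.mul_le_mul_left k (by omega))
    (fun p hp => (Finset.mem_sdiff.1 (hP p hp).2).1)
    (fun p hp => ⟨(Finset.mem_sdiff.1 (hP p hp).1).2, (Finset.mem_sdiff.1 (hP p hp).2).2⟩) hdis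
  refine hB ⟨M', hM', by omega, fun v hv => ?_⟩
  by_cases hvM : v ∈ M.biUnion id
  · exact hsub hvM
  · obtain ⟨p, hp, h | h⟩ := hPcov v (Finset.mem_sdiff.2 ⟨hv, hvM⟩)
    · exact h ▸ (hcov' p hp).1
    · exact h ▸ (hcov' p hp).2

/-- An edge at `v` either contains a heavy neighbour of `v` or one of boundedly many light ones, since
all edges at `v` meet a common set of bounded size. -/
theorem card_edges_disjoint_le (hF : ∀ S ∈ F, S.card = k)
    (hBc : B.card = b) (hB : ¬ Coverable F B) (hmin : ∀ C ⊂ B, Coverable F C)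
    {v : Fin n} (hv : v ∈ B) (C : Finset (Fin n)) :
    (F.filter fun S => v ∈ S ∧ Disjoint S C).card ≤
      (heavyNbrs F (lightCodegree n k b) v \ C).card * (n - 2).choose (k - 2) +
        k * b * lightCodegree n k b := by
  obtain ⟨Y, hvY, hYc, hY⟩ := exists_transversal_of_minimal hF hB hmin hv
  set N := heavyNbrs F (lightCodegree n k b) v with hN
  have hsub : (F.filter fun S => v ∈ S ∧ Disjoint S C) ⊆
      (N \ C).biUnion (fun x => F.filter ({v, x} ⊆ ·)) ∪
        (Y \ N).biUnion fun x => F.filter ({v, x} ⊆ ·) := by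
    intro S hS
    obtain ⟨hS, hvS, hSC⟩ := Finset.mem_filter.1 hS
    obtain ⟨x, hxS, hxY⟩ := Finset.not_disjoint_iff.1 (hY S hS hvS)
    have hmem : S ∈ F.filter ({v, x} ⊆ ·) :=
      Finset.mem_filter.2 ⟨hS, by simp [Finset.insert_subset_iff, hvS, hxS]⟩
    by_cases hx : x ∈ N
    · exact Finset.mem_union_left _ (Finset.mem_biUnion.2
        ⟨x, Finset.mem_sdiff.2 ⟨hx, Finset.disjoint_left.1 hSC hxS⟩, hmem⟩)
    · exact Finset.mem_union_right _ (Finset.mem_biUnion.2 ⟨x, Finset.mem_sdiff.2 ⟨hxY, hx⟩, hmem⟩)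
  refine (Finset.card_le_card hsub).trans ((Finset.card_union_le _ _).trans (Nat.add_le_add ?_ ?_))
  · refine Finset.card_biUnion_le_card_mul _ _ _ fun x hx => card_filter_mem_mem_le hF ?_
    exact (Finset.mem_filter.1 (Finset.mem_sdiff.1 hx).1).2.1.symm
  · refine (Finset.card_biUnion_le_card_mul _ _ (lightCodegree n k b) fun x hx => ?_).trans
      (Nat.mul_le_mul_right _ ?_)
    · obtain ⟨hxY, hxN⟩ := Finset.mem_sdiff.1 hx
      by_contra! hlt
      exact hxN (Finset.mem_filter.2 ⟨Finset.mem_univ _, fun h => hvY (h ▸ hxY), hlt⟩)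
    · exact (Finset.card_le_card Finset.sdiff_subset).trans
        (hYc.trans (Nat.mul_le_mul_left k (by omega)))

theorem card_meeting_union_le_sum (hF : ∀ S ∈ F, S.card = k)
    (hBc : B.card = b) (hB : ¬ Coverable F B) (hmin : ∀ C ⊂ B, Coverable F C)
    {A : Finset (Fin n)} (hA : A ⊆ B) (C : Finset (Fin n)) {h : ℕ}
    (hh : ∀ v ∈ A, (heavyNbrs F (lightCodegree n k b) v \ C).card ≤ h) :
    (meeting F (C ∪ A)).card ≤ (meeting F C).card +
      A.card * (h * (n - 2).choose (k - 2) + k * b * lightCodegree n k b) := by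
  have hsub : meeting F (C ∪ A) ⊆
      meeting F C ∪ A.biUnion fun v => F.filter fun S => v ∈ S ∧ Disjoint S C := by
    intro S hS
    obtain ⟨hS, hd⟩ := Finset.mem_filter.1 hS
    by_cases hSC : Disjoint S C
    · rw [Finset.disjoint_union_right, not_and] at hd
      obtain ⟨v, hvS, hvA⟩ := Finset.not_disjoint_iff.1 (hd hSC)
      exact Finset.mem_union_right _ (Finset.mem_biUnion.2
        ⟨v, hvA, Finset.mem_filter.2 ⟨hS, hvS, hSC⟩⟩)
    · exact Finset.mem_union_left _ (Finset.mem_filter.2 ⟨hS, hSC⟩)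
  refine (Finset.card_le_card hsub).trans ((Finset.card_union_le _ _).trans
    (Nat.add_le_add_left (Finset.card_biUnion_le_card_mul _ _ _ fun v hv => ?_) _))
  exact (card_edges_disjoint_le hF hBc hB hmin (hA hv) C).trans
    (Nat.add_le_add_right (Nat.mul_le_mul_right _ (hh v hv)) _)

theorem card_sdiff_le_of_covers (hF : ∀ S ∈ F, S.card = k) {C : Finset (Fin n)}
    {M : Finset (Finset (Fin n))} (hM : IsMatchingIn F M) (hMc : M.card ≤ C.card)
    (hcov : C ⊆ M.biUnion id) : (M.biUnion id \ C).card ≤ (k - 1) * C.card := by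
  rw [Finset.card_sdiff_of_subset hcov, Nat.sub_mul, one_mul]
  exact Nat.sub_le_sub_right ((card_biUnion_matching_le hF hM).trans (Nat.mul_le_mul_left k hMc)) _

theorem card_meeting_union_le (hF : ∀ S ∈ F, S.card = k)
    (hBc : B.card = b) (hB : ¬ Coverable F B) (hmin : ∀ C ⊂ B, Coverable F C)
    {C : Finset (Fin n)} {M : Finset (Finset (Fin n))} (hM : IsMatchingIn F M)
    (hMc : M.card ≤ C.card) (hcov : C ⊆ M.biUnion id) {A : Finset (Fin n)}
    (hA : A ⊆ B \ M.biUnion id)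
    (hdeg : ∀ v ∈ A, (heavyNbrs F (lightCodegree n k b) v \ M.biUnion id).card < A.card) :
    (meeting F (C ∪ A)).card ≤ (meeting F C).card +
      A.card * (((k - 1) * C.card + (A.card - 1)) * (n - 2).choose (k - 2) +
        k * b * lightCodegree n k b) := by
  refine card_meeting_union_le_sum hF hBc hB hmin (hA.trans Finset.sdiff_subset) C fun v hv => ?_
  have hsub : heavyNbrs F (lightCodegree n k b) v \ C ⊆
      (M.biUnion id \ C) ∪ (heavyNbrs F (lightCodegree n k b) v \ M.biUnion id) := by
    intro x hx
    obtain ⟨hx, hxC⟩ := Finset.mem_sdiff.1 hx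
    by_cases hxM : x ∈ M.biUnion id
    · exact Finset.mem_union_left _ (Finset.mem_sdiff.2 ⟨hxM, hxC⟩)
    · exact Finset.mem_union_right _ (Finset.mem_sdiff.2 ⟨hx, hxM⟩)
  have h1 := Finset.card_le_card hsub
  have h2 := Finset.card_union_le (M.biUnion id \ C)
    (heavyNbrs F (lightCodegree n k b) v \ M.biUnion id)
  have h3 := card_sdiff_le_of_covers hF hM hMc hcov
  have h4 := hdeg v hv
  omega

/-- The step from `c` to `c + a` vertices: the increment of `meetingBound` exceeds the number of new
edges by a multiple of the main term, unless `a = 1`. The term `a * (a - 1)` comes from heavy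
neighbours outside the matching; it is at most `(k - 2) * a.choose 2` because `k ≥ 4`. -/
theorem meetingBound_add (hk : 4 ≤ k) (c a : ℕ) :
    meetingBound n k b c + a * (((k - 1) * c + (a - 1)) * (n - 2).choose (k - 2) +
        k * b * lightCodegree n k b) + a.choose 2 * (n - 2).choose (k - 2) ≤
      meetingBound n k b (c + a) := by
  unfold meetingBound
  set P := (n - 2).choose (k - 2)
  set L := k * b * lightCodegree n k b
  obtain ⟨l, rfl⟩ : ∃ l, k = l + 4 := ⟨k - 4, by omega⟩
  rw [choose_two_add]
  have h1 := mul_pred_eq_two_mul_choose_two a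
  have e : l + 4 - 1 = l + 3 := rfl
  rw [e]
  calc _ = (l + 3) * (c.choose 2 + c * a) * P + (a * (a - 1)) * P + a.choose 2 * P + (c + a) * L := by
        ring
    _ = (l + 3) * (c.choose 2 + c * a) * P + 3 * a.choose 2 * P + (c + a) * L := by rw [h1]; ring
    _ ≤ (l + 3) * (c.choose 2 + c * a) * P + (l + 3) * a.choose 2 * P + (c + a) * L := by
        gcongr
        omega
    _ = _ := by ring

/-- A deficit of one main term anywhere persists up to the whole of `B`. -/
theorem meetingBound_lt_of_subset (hk : 4 ≤ k) (hF : ∀ S ∈ F, S.card = k)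
    (hBc : B.card = b) (hB : ¬ Coverable F B) (hmin : ∀ C ⊂ B, Coverable F C)
    (hbig : meetingBound n k b b < (meeting F B).card + (n - 2).choose (k - 2)) :
    ∀ C ⊆ B, meetingBound n k b C.card < (meeting F C).card + (n - 2).choose (k - 2) := by
  intro C hC
  induction' hm : B.card - C.card using Nat.strong_induction_on with m ih generalizing C
  rcases hC.eq_or_ssubset with rfl | hss
  · rwa [hBc]
  obtain ⟨M, hM, hMc, hcov⟩ := hmin C hss
  obtain ⟨A, hA, hAne, hdeg⟩ := exists_low_degree_outside_matching (by omega) hF hBc hB hC hM hMc hcov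
  have h1 := card_meeting_union_le hF hBc hB hmin hM hMc hcov hA hdeg
  have hdis : Disjoint C A := by
    rw [Finset.disjoint_left]
    exact fun x hxC hxA => (Finset.mem_sdiff.1 (hA hxA)).2 (hcov hxC)
  have hcard := Finset.card_union_of_disjoint hdis
  have hApos := Finset.card_pos.2 hAne
  have hlt := Finset.card_lt_card hss
  have h2 := ih (B.card - (C ∪ A).card) (by omega) (C ∪ A)
    (Finset.union_subset hC (hA.trans Finset.sdiff_subset)) rfl
  have h3 := meetingBound_add (n := n) (b := b) hk C.card A.card
  rw [hcard] at h2
  omega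

/-- If the count of edges meeting `C` is within the bound, every matching that covers `C` singles
out a next vertex `w`, whose heavy neighbours outside `C` are exactly the vertices of the matching
outside `C`. -/
theorem exists_next_vertex (hk : 4 ≤ k) (hF : ∀ S ∈ F, S.card = k)
    (hBc : B.card = b) (hB : ¬ Coverable F B) (hmin : ∀ C ⊂ B, Coverable F C)
    (hbig : meetingBound n k b b < (meeting F B).card + (n - 2).choose (k - 2))
    {C : Finset (Fin n)} (hC : C ⊆ B) (htight : (meeting F C).card ≤ meetingBound n k b C.card)
    {M : Finset (Finset (Fin n))} (hM : IsMatchingIn F M) (hMc : M.card ≤ C.card)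
    (hcov : C ⊆ M.biUnion id) :
    ∃ w ∈ B \ M.biUnion id, heavyNbrs F (lightCodegree n k b) w \ C = M.biUnion id \ C ∧
      (M.biUnion id \ C).card = (k - 1) * C.card ∧
      (meeting F (insert w C)).card ≤ meetingBound n k b (C.card + 1) := by
  obtain ⟨A, hA, hAne, hdeg⟩ := exists_low_degree_outside_matching (by omega) hF hBc hB hC hM hMc hcov
  have h1 := card_meeting_union_le hF hBc hB hmin hM hMc hcov hA hdeg
  have hdis : Disjoint C A := by
    rw [Finset.disjoint_left]
    exact fun x hxC hxA => (Finset.mem_sdiff.1 (hA hxA)).2 (hcov hxC)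
  have hcard := Finset.card_union_of_disjoint hdis
  have hApos := Finset.card_pos.2 hAne
  have h2 := meetingBound_lt_of_subset hk hF hBc hB hmin hbig (C ∪ A)
    (Finset.union_subset hC (hA.trans Finset.sdiff_subset))
  have h3 := meetingBound_add (n := n) (b := b) hk C.card A.card
  rw [hcard] at h2
  have hA2 : A.card.choose 2 = 0 := by
    by_contra hne
    have := Nat.le_mul_of_pos_left ((n - 2).choose (k - 2)) (Nat.pos_of_ne_zero hne)
    omega
  have hA1 : A.card = 1 := by
    rw [Nat.choose_eq_zero_iff] at hA2
    omega
  obtain ⟨w, rfl⟩ := Finset.card_eq_one.1 hA1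
  have hw := hA (Finset.mem_singleton_self w)
  have hsub : heavyNbrs F (lightCodegree n k b) w \ C ⊆ M.biUnion id \ C := by
    have h4 := hdeg w (Finset.mem_singleton_self w)
    rw [hA1, Nat.lt_one_iff, Finset.card_eq_zero, Finset.sdiff_eq_empty_iff_subset] at h4
    exact Finset.sdiff_subset_sdiff h4 subset_rfl
  have h5 := card_sdiff_le_of_covers hF hM hMc hcov
  -- fewer heavy neighbours would create a deficit at `insert w C`
  have h6 : (k - 1) * C.card ≤ (heavyNbrs F (lightCodegree n k b) w \ C).card := by
    by_contra! hlt
    have h7 := card_meeting_union_le_sum (A := {w}) hF hBc hB hmin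
      (Finset.singleton_subset_iff.2 (Finset.mem_sdiff.1 hw).1) C (h := (k - 1) * C.card - 1)
      (fun v hv => by rw [Finset.mem_singleton.1 hv]; omega)
    rw [hA1] at h2 h3 h7
    simp only [Nat.sub_self, add_zero, one_mul] at h3 h7
    have h8 : (k - 1) * C.card * (n - 2).choose (k - 2) =
        ((k - 1) * C.card - 1) * (n - 2).choose (k - 2) + (n - 2).choose (k - 2) := by
      rw [← Nat.succ_mul]
      congr 1
      omega
    omega
  have heq := Finset.eq_of_subset_of_card_le hsub (h5.trans h6)
  refine ⟨w, hw, heq, le_antisymm h5 (heq ▸ h6), ?_⟩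
  rw [hA1] at h1 h3
  rw [Finset.insert_eq, Finset.union_comm]
  omega

end

/-! ### Rigidity -/

section

variable {n k b : ℕ} {F : Finset (Finset (Fin n))} {B : Finset (Fin n)}

/-- Iterating the choice of the next vertex lists `B`, keeping the count of edges within the bound. -/
theorem exists_chain (hk : 4 ≤ k) (hF : ∀ S ∈ F, S.card = k)
    (hBc : B.card = b) (hb : 1 ≤ b) (hB : ¬ Coverable F B) (hmin : ∀ C ⊂ B, Coverable F C)
    (hbig : meetingBound n k b b < (meeting F B).card + (n - 2).choose (k - 2)) :
    ∃ v : ℕ → Fin n,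
      (∀ i ≤ b, (Finset.range i).image v ⊆ B ∧ ((Finset.range i).image v).card = i ∧
        (meeting F ((Finset.range i).image v)).card ≤ meetingBound n k b i) ∧
      ∀ i < b, (heavyNbrs F (lightCodegree n k b) (v i) \ (Finset.range i).image v).card =
        (k - 1) * i := by
  have hnext : ∀ C : Finset (Fin n), ∃ w, C ⊂ B →
      (meeting F C).card ≤ meetingBound n k b C.card → w ∈ B ∧ w ∉ C ∧
      (heavyNbrs F (lightCodegree n k b) w \ C).card = (k - 1) * C.card ∧
      (meeting F (insert w C)).card ≤ meetingBound n k b (C.card + 1) := by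
    intro C
    by_cases hC : C ⊂ B ∧ (meeting F C).card ≤ meetingBound n k b C.card
    · obtain ⟨M, hM, hMc, hcov⟩ := hmin C hC.1
      obtain ⟨w, hw, h1, h2, h3⟩ := exists_next_vertex hk hF hBc hB hmin hbig hC.1.1 hC.2 hM hMc hcov
      obtain ⟨hwB, hwM⟩ := Finset.mem_sdiff.1 hw
      exact ⟨w, fun _ _ => ⟨hwB, fun h => hwM (hcov h), h1 ▸ h2, h3⟩⟩
    · obtain ⟨w, -⟩ := Finset.card_pos.1 (show 0 < B.card by omega)
      exact ⟨w, fun h1 h2 => absurd ⟨h1, h2⟩ hC⟩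
  choose w hw using hnext
  set Cs : ℕ → Finset (Fin n) := fun i => Nat.rec ∅ (fun _ C => insert (w C) C) i with hCs
  have hsucc : ∀ i, Cs (i + 1) = insert (w (Cs i)) (Cs i) := fun _ => rfl
  have himage : ∀ i, (Finset.range i).image (fun j => w (Cs j)) = Cs i := by
    intro i
    induction i with
    | zero => rfl
    | succ i ih => rw [Finset.range_add_one, Finset.image_insert, ih, hsucc]
  have hall : ∀ i ≤ b, Cs i ⊆ B ∧ (Cs i).card = i ∧ (meeting F (Cs i)).card ≤ meetingBound n k b i := by
    intro i
    induction i with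
    | zero =>
      intro _
      refine ⟨Finset.empty_subset _, rfl, ?_⟩
      have : meeting F (Cs 0) = ∅ := Finset.filter_eq_empty_iff.2 fun S _ h =>
        h (Finset.disjoint_empty_right S)
      rw [this]
      exact Nat.zero_le _
    | succ i ih =>
      intro hi
      obtain ⟨h1, h2, h3⟩ := ih (by omega)
      have hss : Cs i ⊂ B := h1.ssubset_of_ne fun h => by rw [h] at h2; omega
      obtain ⟨h4, h5, -, h6⟩ := hw (Cs i) hss (by rwa [h2])
      rw [hsucc]
      exact ⟨Finset.insert_subset h4 h1, by rw [Finset.card_insert_of_notMem h5, h2], by rwa [h2] at h6⟩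
  refine ⟨fun i => w (Cs i), fun i hi => by rw [himage]; exact hall i hi, fun i hi => ?_⟩
  obtain ⟨h1, h2, h3⟩ := hall i hi.le
  have hss : Cs i ⊂ B := h1.ssubset_of_ne fun h => by rw [h] at h2; omega
  rw [himage, (hw (Cs i) hss (by rwa [h2])).2.2.1, h2]

/-- The vertices of `B` can be listed as `v 0, …, v (b - 1)` such that any matching of size at most
`i` covering `v 0, …, v (i - 1)` avoids `v i`, and its further vertices are determined. -/
theorem exists_rigid_enumeration (hk : 4 ≤ k) (hF : ∀ S ∈ F, S.card = k)
    (hBc : B.card = b) (hb : 1 ≤ b) (hB : ¬ Coverable F B) (hmin : ∀ C ⊂ B, Coverable F C)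
    (hbig : meetingBound n k b b < (meeting F B).card + (n - 2).choose (k - 2)) :
    ∃ (v : ℕ → Fin n) (X : ℕ → Finset (Fin n)), (Finset.range b).image v = B ∧
      ∀ i < b, ∀ M, IsMatchingIn F M → M.card ≤ i → (∀ j < i, v j ∈ M.biUnion id) →
        v i ∉ M.biUnion id ∧ M.biUnion id \ (Finset.range i).image v = X i := by
  obtain ⟨v, hv, hN⟩ := exists_chain hk hF hBc hb hB hmin hbig
  have hvB : (Finset.range b).image v = B :=
    Finset.eq_of_subset_of_card_le (hv b le_rfl).1 (by rw [(hv b le_rfl).2.1, hBc])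
  refine ⟨v, fun i => heavyNbrs F (lightCodegree n k b) (v i) \ (Finset.range i).image v, hvB, ?_⟩
  intro i hi M hM hMc hcov
  obtain ⟨h1, h2, h3⟩ := hv i hi.le
  have hsub : (Finset.range i).image v ⊆ M.biUnion id := by
    intro x hx
    obtain ⟨j, hj, rfl⟩ := Finset.mem_image.1 hx
    exact hcov j (Finset.mem_range.1 hj)
  obtain ⟨w, hw, h4, h5, -⟩ := exists_next_vertex hk hF hBc hB hmin hbig h1 (by rwa [h2]) hM
    (by rwa [h2]) hsub
  obtain ⟨hwB, hwM⟩ := Finset.mem_sdiff.1 hw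
  rw [← hvB] at hwB
  obtain ⟨j, hj, rfl⟩ := Finset.mem_image.1 hwB
  have hj := Finset.mem_range.1 hj
  -- the number of heavy neighbours of `v j` outside the first `i` vertices forces `j = i`
  have hij : i ≤ j := by
    by_contra! hlt
    exact hwM (hcov j hlt)
  have hji : j ≤ i := by
    have h6 : heavyNbrs F (lightCodegree n k b) (v j) \ (Finset.range j).image v ⊆
        heavyNbrs F (lightCodegree n k b) (v j) \ (Finset.range i).image v :=
      Finset.sdiff_subset_sdiff subset_rfl
        (Finset.image_subset_image (Finset.range_subset_range.2 hij))
    have h7 := Finset.card_le_card h6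
    rw [h4, h5, h2, hN j hj] at h7
    exact Nat.le_of_mul_le_mul_left h7 (by omega)
  obtain rfl : j = i := le_antisymm hji hij
  exact ⟨hwM, h4.symm⟩

/-- A family whose count of edges meeting `B` is nearly as large as possible consists of edges of
the extremal form. -/
theorem exists_extremal_structure (hk : 4 ≤ k) (hF : ∀ S ∈ F, S.card = k)
    (hBc : B.card = b) (hb : 1 ≤ b) (hB : ¬ Coverable F B) (hmin : ∀ C ⊂ B, Coverable F C)
    (hbig : meetingBound n k b b < (meeting F B).card + (n - 2).choose (k - 2)) :
    ∃ (v : ℕ → Fin n) (E : ℕ → Finset (Fin n)),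
      (∀ i < b, ∀ j < b, v i = v j → i = j) ∧ (∀ j < b - 1, (E j).card = k - 1) ∧
      (∀ j < b - 1, ∀ i < b, v i ∉ E j) ∧
      (∀ i < b - 1, ∀ j < b - 1, i ≠ j → Disjoint (E i) (E j)) ∧
      ∀ S ∈ F, ∀ i < b, v i ∈ S → (∀ j < i, v j ∉ S) →
        (i < b - 1 ∧ S = insert (v i) (E i)) ∨ ∃ j < i, ¬ Disjoint S (E j) := by
  obtain ⟨v, X, hvB, hrigid⟩ := exists_rigid_enumeration hk hF hBc hb hB hmin hbig
  have hvinj : ∀ i < b, ∀ j < b, v i = v j → i = j := by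
    have hinj : Set.InjOn v (Finset.range b) := by
      rw [← Finset.card_image_iff, hvB, hBc, Finset.card_range]
    exact fun i hi j hj h => hinj (by simpa using hi) (by simpa using hj) h
  have hvmem : ∀ i < b, v i ∈ B := fun i hi =>
    hvB ▸ Finset.mem_image_of_mem v (Finset.mem_range.2 hi)
  obtain ⟨M, hM, -, hMcov⟩ := hmin _ (Finset.erase_ssubset (hvmem (b - 1) (by omega)))
  have hsel : ∀ i, ∃ S, i < b - 1 → S ∈ M ∧ v i ∈ S := by
    intro i
    by_cases hi : i < b - 1
    · obtain ⟨S, hS, hiS⟩ := Finset.mem_biUnion.1 (hMcov (Finset.mem_erase.2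
        ⟨fun h => absurd (hvinj i (by omega) (b - 1) (by omega) h) (by omega),
          hvmem i (by omega)⟩))
      exact ⟨S, fun _ => ⟨hS, hiS⟩⟩
    · exact ⟨∅, fun h => absurd h hi⟩
  choose e he using hsel
  have hmem_biUnion : ∀ i x, x ∈ ((Finset.range i).image e).biUnion id ↔ ∃ j < i, x ∈ e j := by
    intro i x
    simp
  have hmatch : ∀ i < b, IsMatchingIn F ((Finset.range i).image e) := by
    intro i hi
    refine hM.mono fun S hS => ?_
    obtain ⟨j, hj, rfl⟩ := Finset.mem_image.1 hS
    exact (he j (by have := Finset.mem_range.1 hj; omega)).1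
  have hmcard : ∀ i, ((Finset.range i).image e).card ≤ i := fun i =>
    Finset.card_image_le.trans (Finset.card_range i).le
  have hchain : ∀ i < b, (∀ j < i, v i ∉ e j) ∧
      ((Finset.range i).image e).biUnion id \ (Finset.range i).image v = X i := by
    intro i hi
    obtain ⟨h1, h2⟩ := hrigid i hi _ (hmatch i hi) (hmcard i)
      (fun j hj => (hmem_biUnion i _).2 ⟨j, hj, (he j (by omega)).2⟩)
    exact ⟨fun j hj h => h1 ((hmem_biUnion i _).2 ⟨j, hj, h⟩), h2⟩
  have hedis_lt : ∀ i < b - 1, ∀ j < i, Disjoint (e i) (e j) := by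
    intro i hi j hj
    refine hM.2 _ (he i hi).1 _ (he j (by omega)).1 fun h => ?_
    exact (hchain i (by omega)).1 j hj (h ▸ (he i hi).2)
  have hedis : ∀ i < b - 1, ∀ j < b - 1, i ≠ j → Disjoint (e i) (e j) := by
    intro i hi j hj hne
    rcases Nat.lt_or_gt_of_ne hne with h | h
    · exact (hedis_lt j hj i h).symm
    · exact hedis_lt i hi j h
  refine ⟨v, fun j => (e j).erase (v j), hvinj, ?_, ?_, ?_, ?_⟩
  · intro j hj
    rw [Finset.card_erase_of_mem (he j hj).2, hF _ (hM.1 (he j hj).1)]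
  · intro j hj i hi h
    obtain ⟨hne, hmem⟩ := Finset.mem_erase.1 h
    rcases Nat.lt_trichotomy i j with hij | rfl | hij
    · exact Finset.disjoint_left.1 (hedis_lt j hj i hij) hmem (he i (by omega)).2
    · exact hne rfl
    · exact (hchain i hi).1 j hij hmem
  · intro i hi j hj hne
    exact ((hedis i hi j hj hne).mono_left (Finset.erase_subset _ _)).mono_right
      (Finset.erase_subset _ _)
  · intro S hS i hi hiS hmin'
    by_contra! hno
    obtain ⟨hno1, hno2⟩ := hno
    -- now `S` and the earlier edges form a matching covering `v 0, …, v i`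
    have hSe : ∀ j < i, Disjoint S (e j) := by
      intro j hj
      rw [← Finset.insert_erase (he j (by omega)).2, Finset.disjoint_insert_right]
      exact ⟨hmin' j hj, hno2 j hj⟩
    have hSd : Disjoint S (((Finset.range i).image e).biUnion id) := by
      rw [Finset.disjoint_left]
      intro x hx hx'
      obtain ⟨j, hj, h⟩ := (hmem_biUnion i x).1 hx'
      exact Finset.disjoint_left.1 (hSe j hj) hx h
    have hM' := (hmatch i hi).insert hS hSd
    have hc : (insert S ((Finset.range i).image e)).card ≤ i + 1 :=
      (Finset.card_insert_le _ _).trans (Nat.add_le_add_right (hmcard i) 1)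
    have hcov : ∀ j < i + 1, v j ∈ (insert S ((Finset.range i).image e)).biUnion id := by
      intro j hj
      rw [Finset.biUnion_insert, Finset.mem_union, hmem_biUnion]
      rcases Nat.lt_succ_iff_lt_or_eq.1 hj with h | rfl
      · exact Or.inr ⟨j, h, (he j (by omega)).2⟩
      · exact Or.inl hiS
    rcases Nat.lt_or_ge (i + 1) b with hib | hib
    · have h1 := (hrigid (i + 1) hib _ hM' hc hcov).2
      rw [← (hchain (i + 1) hib).2] at h1
      have hsub : S ⊆ e i := by
        intro x hx
        by_cases hxv : x ∈ (Finset.range (i + 1)).image v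
        · obtain ⟨j, hj, rfl⟩ := Finset.mem_image.1 hxv
          have hj := Finset.mem_range.1 hj
          rcases Nat.lt_succ_iff_lt_or_eq.1 hj with h | rfl
          · exact absurd hx (hmin' j h)
          · exact (he j (by omega)).2
        · have h2 : x ∈ (insert S ((Finset.range i).image e)).biUnion id \
              (Finset.range (i + 1)).image v := by
            rw [Finset.mem_sdiff, Finset.biUnion_insert]
            exact ⟨Finset.mem_union_left _ hx, hxv⟩
          rw [h1] at h2
          obtain ⟨j, hj, hxj⟩ := (hmem_biUnion _ x).1 (Finset.mem_sdiff.1 h2).1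
          rcases Nat.lt_succ_iff_lt_or_eq.1 hj with h | rfl
          · exact absurd hxj (Finset.disjoint_left.1 (hSe j h) hx)
          · exact hxj
      have heq := Finset.eq_of_subset_of_card_le hsub
        (by rw [hF S hS, hF _ (hM.1 (he i (by omega)).1)])
      apply hno1 (by omega)
      rw [Finset.insert_erase (he i (by omega)).2, heq]
    · refine hB ⟨_, hM', by omega, ?_⟩
      rw [← hvB]
      intro x hx
      obtain ⟨j, hj, rfl⟩ := Finset.mem_image.1 hx
      exact hcov j (by have := Finset.mem_range.1 hj; omega)

end

/-! ### Embedding into a copy of the extremal family -/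

theorem exists_perm_comp_eq {α ι : Type*} [Finite α] {p q : ι → α}
    (hp : Function.Injective p) (hq : Function.Injective q) :
    ∃ σ : Equiv.Perm α, ∀ i, σ (p i) = q i := by
  classical
  refine ⟨((Equiv.ofInjective p hp).symm.trans (Equiv.ofInjective q hq)).extendSubtype, fun i => ?_⟩
  rw [Equiv.extendSubtype_apply_of_mem _ _ (Set.mem_range_self i)]
  have : (⟨p i, Set.mem_range_self i⟩ : Set.range p) = Equiv.ofInjective p hp i := rfl
  rw [this, Equiv.trans_apply, Equiv.symm_apply_apply]
  rfl

/-- A family of the extremal form embeds into a copy of the extremal family. -/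
theorem exists_perm_subset_image {n k b : ℕ} {F : Finset (Finset (Fin n))}
    (hbn : b ≤ n) (hF : ∀ S ∈ F, S.card = k) {E : Fin (b - 1) → Finset (Fin n)}
    (hE : IsBaseSystem k b E) {v : ℕ → Fin n} {E' : ℕ → Finset (Fin n)}
    (hv : ∀ i < b, ∀ j < b, v i = v j → i = j) (hE'c : ∀ j < b - 1, (E' j).card = k - 1)
    (hvE' : ∀ j < b - 1, ∀ i < b, v i ∉ E' j)
    (hE'd : ∀ i < b - 1, ∀ j < b - 1, i ≠ j → Disjoint (E' i) (E' j))
    (hstruct : ∀ S ∈ F, ∀ i < b, v i ∈ S → (∀ j < i, v j ∉ S) →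
        (i < b - 1 ∧ S = insert (v i) (E' i)) ∨ ∃ j < i, ¬ Disjoint S (E' j)) :
    ∃ σ : Equiv.Perm (Fin n), F ⊆ (franklFamily k b E).image (Finset.image σ) := by
  have hpinj : Function.Injective (Sum.elim (fun i : Fin b => (⟨i.val, by omega⟩ : Fin n))
      fun p : Fin (b - 1) × Fin (k - 1) => (E p.1).orderEmbOfFin (hE.1 p.1) p.2) := by
    refine Function.Injective.sumElim ?_ ?_ ?_
    · intro i j h
      simpa [Fin.ext_iff] using h
    · rintro ⟨i, t⟩ ⟨j, u⟩ h
      simp only at h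
      have hij : i = j := by
        by_contra hne
        exact Finset.disjoint_left.1 (hE.2.2 i j hne) (Finset.orderEmbOfFin_mem _ (hE.1 i) t)
          (h ▸ Finset.orderEmbOfFin_mem _ (hE.1 j) u)
      subst hij
      rw [((E i).orderEmbOfFin (hE.1 i)).injective h]
    · rintro i ⟨j, t⟩ h
      have := hE.2.1 j _ (h ▸ Finset.orderEmbOfFin_mem _ (hE.1 j) t)
      simp only at this
      omega
  have hqinj : Function.Injective (Sum.elim (fun i : Fin b => v i.val)
      fun p : Fin (b - 1) × Fin (k - 1) =>
        (E' p.1.val).orderEmbOfFin (hE'c p.1.val p.1.isLt) p.2) := by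
    refine Function.Injective.sumElim ?_ ?_ ?_
    · exact fun i j h => Fin.ext (hv i i.isLt j j.isLt h)
    · rintro ⟨i, t⟩ ⟨j, u⟩ h
      simp only at h
      have hij : i = j := by
        by_contra hne
        exact Finset.disjoint_left.1 (hE'd i i.isLt j j.isLt fun h => hne (Fin.ext h))
          (Finset.orderEmbOfFin_mem _ (hE'c i i.isLt) t)
          (h ▸ Finset.orderEmbOfFin_mem _ (hE'c j j.isLt) u)
      subst hij
      rw [((E' i).orderEmbOfFin (hE'c i i.isLt)).injective h]
    · rintro i ⟨j, t⟩ h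
      exact hvE' j j.isLt i i.isLt (h ▸ Finset.orderEmbOfFin_mem _ (hE'c j j.isLt) t)
  obtain ⟨σ, hσ⟩ := exists_perm_comp_eq hpinj hqinj
  have hσv : ∀ i (hi : i < b), σ ⟨i, by omega⟩ = v i := fun i hi => hσ (Sum.inl ⟨i, hi⟩)
  have hσE : ∀ j : Fin (b - 1), (E' j.val).image σ.symm = E j := by
    intro j
    refine Finset.eq_of_subset_of_card_le ?_ ?_
    · intro x hx
      obtain ⟨y, hy, rfl⟩ := Finset.mem_image.1 hx
      obtain ⟨t, rfl⟩ : y ∈ Set.range ((E' j.val).orderEmbOfFin (hE'c j j.isLt)) := by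
        rw [Finset.range_orderEmbOfFin]
        exact hy
      have h1 : σ ((E j).orderEmbOfFin (hE.1 j) t) =
          (E' j.val).orderEmbOfFin (hE'c j j.isLt) t := hσ (Sum.inr (j, t))
      rw [← h1, Equiv.symm_apply_apply]
      exact Finset.orderEmbOfFin_mem _ _ _
    · rw [Finset.card_image_of_injective _ σ.symm.injective, hE.1 j, hE'c j j.isLt]
  refine ⟨σ, fun S hS => Finset.mem_image.2 ⟨S.image σ.symm, ?_, ?_⟩⟩
  swap
  · rw [Finset.image_image, Equiv.self_comp_symm, Finset.image_id]
  have hmem : ∀ x, x ∈ S.image σ.symm ↔ σ x ∈ S := by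
    intro x
    simp [Finset.mem_image, Equiv.symm_apply_eq]
  have hc : (S.image σ.symm).card = k := by
    rw [Finset.card_image_of_injective _ σ.symm.injective, hF S hS]
  rw [mem_franklFamily]
  by_cases hmeet : ∃ i, i < b ∧ v i ∈ S
  · right
    obtain ⟨i, ⟨hib, hiS⟩, hfirst⟩ : ∃ i, (i < b ∧ v i ∈ S) ∧ ∀ j < i, v j ∉ S := by
      classical
      refine ⟨Nat.find hmeet, Nat.find_spec hmeet, fun j hj h => Nat.find_min hmeet hj ⟨?_, h⟩⟩
      exact hj.trans (Nat.find_spec hmeet).1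
    refine ⟨⟨i, hib.trans_le hbn⟩, hib, mem_franklPart.2 ?_⟩
    rcases hstruct S hS i hib hiS hfirst with ⟨hi, h⟩ | ⟨j, hj, h⟩
    · refine Or.inl ⟨⟨i, hi⟩, rfl, ?_⟩
      rw [h, Finset.image_insert, ← hσE ⟨i, hi⟩, ← hσv i hib, Equiv.symm_apply_apply]
    · refine Or.inr ⟨hc, ?_, ?_, ⟨j, by omega⟩, hj, ?_⟩
      · rwa [hmem, hσv i hib]
      · intro x hx
        rw [hmem] at hx
        by_contra! hlt
        have hlt' : x.val < i := hlt
        exact hfirst x.val hlt' (by rw [← hσv x.val (by omega)]; exact hx)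
      · intro hd
        rw [← hσE ⟨j, by omega⟩, Finset.disjoint_image σ.symm.injective] at hd
        exact h hd
  · left
    push Not at hmeet
    refine ⟨hc, fun x hx => ?_⟩
    by_contra! hlt
    rw [hmem] at hx
    exact hmeet x.val hlt (by rw [← hσv x.val hlt]; exact hx)

/-! ### Estimates for large `s` and the conclusion -/

theorem choose_le_choose_sub_add (n k a : ℕ) (hk : 1 ≤ k) (ha : a ≤ n) :
    n.choose k ≤ (n - a).choose k + a * (n - 1).choose (k - 1) := by
  induction a with
  | zero => simp
  | succ a ih =>
    have h1 := ih (by omega)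
    obtain ⟨k, rfl⟩ : ∃ l, k = l + 1 := ⟨k - 1, by omega⟩
    have h2 : n - a = (n - (a + 1)) + 1 := by omega
    rw [h2, Nat.choose_succ_succ'] at h1
    have h3 : (n - (a + 1)).choose k ≤ (n - 1).choose k := Nat.choose_le_choose k (by omega)
    rw [Nat.add_sub_cancel] at h1 ⊢
    rw [Nat.succ_mul]
    omega

theorem mul_choose_lt_choose_succ {K m r : ℕ} (hr : r ≤ m) (h : K * (r + 1) < m + 1) :
    K * m.choose r < (m + 1).choose (r + 1) := by
  have h1 := Nat.add_one_mul_choose_eq m r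
  have h2 := Nat.choose_pos hr
  have h3 : K * m.choose r * (r + 1) < (m + 1).choose (r + 1) * (r + 1) := by
    rw [← h1]
    nlinarith
  exact Nat.lt_of_mul_lt_mul_right h3

theorem choose_le_pow_mul_choose {N m r R : ℕ} (h : N ≤ R * (m + 1 - r)) :
    N.choose r ≤ R ^ r * m.choose r := by
  refine Nat.le_of_mul_le_mul_left ?_ (Nat.factorial_pos r)
  calc r.factorial * N.choose r = N.descFactorial r := (Nat.descFactorial_eq_factorial_mul_choose N r).symm
    _ ≤ N ^ r := Nat.descFactorial_le_pow N r
    _ ≤ (R * (m + 1 - r)) ^ r := Nat.pow_le_pow_left h r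
    _ = R ^ r * (m + 1 - r) ^ r := mul_pow _ _ _
    _ ≤ R ^ r * m.descFactorial r := Nat.mul_le_mul_left _ (Nat.pow_sub_le_descFactorial m r)
    _ = r.factorial * (R ^ r * m.choose r) := by
        rw [Nat.descFactorial_eq_factorial_mul_choose]; ring

theorem card_missing_add_card {n k : ℕ} {F : Finset (Finset (Fin n))} (hF : ∀ S ∈ F, S.card = k) :
    (missing k F).card + F.card = n.choose k := by
  rw [missing, Finset.card_sdiff_add_card_eq_card, Finset.card_powersetCard, Finset.card_univ,
    Fintype.card_fin]
  exact fun S hS => Finset.mem_powersetCard.2 ⟨Finset.subset_univ _, hF S hS⟩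

theorem card_le_card_meeting_add {n k : ℕ} {F : Finset (Finset (Fin n))}
    (hF : ∀ S ∈ F, S.card = k) (B : Finset (Fin n)) :
    F.card ≤ (meeting F B).card + (n - B.card).choose k := by
  have h := Finset.card_filter_add_card_filter_not (s := F) fun S => Disjoint S B
  have h2 : (F.filter fun S => Disjoint S B).card ≤ ((Finset.univ \ B).powersetCard k).card := by
    refine Finset.card_le_card fun S hS => ?_
    obtain ⟨hS, hd⟩ := Finset.mem_filter.1 hS
    exact Finset.mem_powersetCard.2 ⟨fun x hx => Finset.mem_sdiff.2
      ⟨Finset.mem_univ x, Finset.disjoint_left.1 hd hx⟩, hF S hS⟩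
  rw [Finset.card_powersetCard, Finset.card_sdiff_of_subset (Finset.subset_univ _),
    Finset.card_univ, Fintype.card_fin] at h2
  unfold meeting
  omega

/-- A bound, depending on `k` and `b` only, for the number of vertices that lie in at least about
`s ^ (k - 1)` missing sets (up to a constant factor). -/
def exceptionalBound (k b : ℕ) : ℕ := k * (k * (b * (8 * k) ^ (k - 1)))

/-- For large `s`, an admissible family at least as large as the extremal one lies in a copy of it. -/
theorem exists_perm_of_card_ge {n k s b c : ℕ} (hk : 4 ≤ k) (hb : 1 ≤ b)
    (hcdef : c = exceptionalBound k b) (hn : n = k * s)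
    (hs1 : 2 * c + 4 * k + b * k + b + 4 ≤ s)
    (hs2 : ((b + 1) * b + (b + 1) * (k * c)) * k ≤ s)
    (hs3 : ((k - 1) * b.choose 2 * (b * k) + b * (k * b * (k * b))) * k + 1 ≤ s)
    {E : Fin (b - 1) → Finset (Fin n)} (hE : IsBaseSystem k b E)
    {F : Finset (Finset (Fin n))} (hF : IsAdmissible k s b F)
    (hcard : (franklFamily k b E).card ≤ F.card) :
    ∃ σ : Equiv.Perm (Fin n), F ⊆ (franklFamily k b E).image (Finset.image σ) := by
  have hks : 4 * s ≤ n := hn ▸ Nat.mul_le_mul_right s hk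
  have hfr := le_card_franklFamily hE (by omega) hb (by omega)
  have hmc := card_missing_add_card hF.1
  have hch := choose_le_choose_sub_add n k b (by omega) (by omega)
  have hkb : 2 ≤ b * k := le_trans (by omega) (Nat.mul_le_mul hb hk)
  -- the threshold for the missing degree
  obtain ⟨X, hX⟩ : ∃ X, X = ((s - c) / 2).choose (k - 1) := ⟨_, rfl⟩
  have hXpos : 0 < X := hX ▸ Nat.choose_pos (by omega)
  obtain ⟨d, hd⟩ : ∃ d, d = (X - 1) / k := ⟨_, rfl⟩
  have hd1 : k * d < X := by
    have := Nat.mul_div_le (X - 1) k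
    rw [← hd] at this
    omega
  have hd2 : X ≤ k * (d + 1) := by
    have := Nat.lt_mul_div_succ (X - 1) (show 0 < k by omega)
    rw [← hd] at this
    omega
  -- `(s - c) / 2` is at least about `s / 8` even after subtracting `k - 1`
  have hC1 : (n - 1).choose (k - 1) ≤ (8 * k) ^ (k - 1) * X := by
    rw [hX]
    refine choose_le_pow_mul_choose ?_
    have h1 : s ≤ 8 * ((s - c) / 2 + 1 - (k - 1)) := by omega
    calc n - 1 ≤ k * s := by omega
      _ ≤ k * (8 * ((s - c) / 2 + 1 - (k - 1))) := Nat.mul_le_mul_left k h1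
      _ = _ := by ring
  have hc : k * (b * (n - 1).choose (k - 1)) < (c + 1) * (d + 1) := by
    refine Nat.lt_of_mul_lt_mul_left (a := k) ?_
    calc k * (k * (b * (n - 1).choose (k - 1))) ≤ k * (k * (b * ((8 * k) ^ (k - 1) * X))) := by
          gcongr
      _ = c * X := by rw [hcdef, exceptionalBound]; ring
      _ < (c + 1) * X := by
          rw [Nat.succ_mul]
          omega
      _ ≤ (c + 1) * (k * (d + 1)) := Nat.mul_le_mul_left _ hd2
      _ = k * ((c + 1) * (d + 1)) := by ring
  have hlarge : b * (n - 1).choose (k - 1) + (b + 1) * (k * c * (n - 2).choose (k - 2)) <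
      (b + 1) * (n - (b + 1)).choose (k - 1) := by
    have h1 := choose_le_choose_sub_add (n - 1) (k - 1) b (by omega) (by omega)
    have h2 := mul_choose_lt_choose_succ (K := (b + 1) * b + (b + 1) * (k * c)) (m := n - 2)
      (r := k - 2) (by omega) (by
        rw [show k - 2 + 1 = k - 1 by omega]
        refine lt_of_le_of_lt ((Nat.mul_le_mul_left _ (Nat.sub_le k 1)).trans hs2) ?_
        omega)
    rw [show n - 1 - b = n - (b + 1) by omega, show n - 1 - 1 = n - 2 by omega,
      show k - 1 - 1 = k - 2 by omega] at h1
    rw [show n - 2 + 1 = n - 1 by omega, show k - 2 + 1 = k - 1 by omega] at h2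
    have h3 := Nat.mul_le_mul_left (b + 1) h1
    generalize (n - 1).choose (k - 1) = C₁ at h2 h3 ⊢
    generalize (n - 2).choose (k - 2) = C₂ at h2 h3 ⊢
    generalize (n - (b + 1)).choose (k - 1) = C₃ at h3 ⊢
    linarith
  obtain ⟨B, hBc, hB, hmin⟩ := hF.exists_minimal_uncoverable (by omega) hn (by omega)
    (by omega) hc (hX ▸ hd1) hlarge
  have hbig : meetingBound n k b b < (meeting F B).card + (n - 2).choose (k - 2) := by
    have h1 := card_le_card_meeting_add hF.1 B
    rw [hBc] at h1
    have h2 : (k - 1) * b.choose 2 * (n - b * k).choose (k - 2) ≤ (meeting F B).card := by omega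
    have hbk : b * k ≤ n := by omega
    have h3 := choose_le_choose_sub_add (n - 2) (k - 2) (b * k - 2) (by omega) (by omega)
    rw [show n - 2 - (b * k - 2) = n - b * k by omega, show n - 2 - 1 = n - 3 by omega,
      show k - 2 - 1 = k - 3 by omega] at h3
    have h4 := mul_choose_lt_choose_succ
      (K := (k - 1) * b.choose 2 * (b * k) + b * (k * b * (k * b))) (m := n - 3)
      (r := k - 3) (by omega) (by
        rw [show k - 3 + 1 = k - 2 by omega]
        have := Nat.mul_le_mul_left ((k - 1) * b.choose 2 * (b * k) + b * (k * b * (k * b)))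
          (Nat.sub_le k 2)
        omega)
    rw [show n - 3 + 1 = n - 2 by omega, show k - 3 + 1 = k - 2 by omega] at h4
    have h5 : (n - 2).choose (k - 2) ≤
        (n - b * k).choose (k - 2) + b * k * (n - 3).choose (k - 3) :=
      h3.trans (Nat.add_le_add_left (Nat.mul_le_mul_right _ (Nat.sub_le _ _)) _)
    have h6 := Nat.mul_le_mul_left ((k - 1) * b.choose 2) h5
    unfold meetingBound lightCodegree
    generalize (k - 1) * b.choose 2 = m at h2 h4 h6 ⊢
    generalize (n - 2).choose (k - 2) = C₁ at h4 h6 ⊢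
    generalize (n - 3).choose (k - 3) = C₂ at h4 h6 ⊢
    generalize (n - b * k).choose (k - 2) = C₃ at h2 h6 ⊢
    linarith
  obtain ⟨v, E', hv, hE'c, hvE', hE'd, hstruct⟩ :=
    exists_extremal_structure hk hF.1 hBc hb hB hmin hbig
  exact exists_perm_subset_image (by omega) hF.1 hE hv hE'c hvE' hE'd hstruct

theorem mainTheorem1 :
    ∃ s₀ : ℕ → ℕ → ℕ, ∀ k b : ℕ, 1 ≤ b → (100 ≤ k ∨ max (b + 1) 6 ≤ k) →
      ∀ s : ℕ, s₀ k b ≤ s → ∀ n : ℕ, n = k * s →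
        ∀ E : Fin (b - 1) → Finset (Fin n), IsBaseSystem k b E →
          IsAdmissible k s b (franklFamily k b E) ∧
          ∀ F : Finset (Finset (Fin n)), IsAdmissible k s b F →
            F.card ≤ (franklFamily k b E).card ∧
            (F.card = (franklFamily k b E).card →
              ∃ σ : Equiv.Perm (Fin n), F = (franklFamily k b E).image (Finset.image σ)) := by
  refine ⟨fun k b => (2 * exceptionalBound k b + 4 * k + b * k + b + 4) +
    ((b + 1) * b + (b + 1) * (k * exceptionalBound k b)) * k +
    (((k - 1) * b.choose 2 * (b * k) + b * (k * b * (k * b))) * k + 1), ?_⟩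
  intro k b hb hkb s hs n hn E hE
  simp only at hs
  have hk : 4 ≤ k := by omega
  have hks : 4 * s ≤ n := hn ▸ Nat.mul_le_mul_right s hk
  refine ⟨franklFamily_isAdmissible hE (by omega) hb (by rw [mul_comm k b]; omega), ?_⟩
  intro F hF
  have hσ := exists_perm_of_card_ge hk hb rfl hn (by omega) (by omega) (by omega) hE hF
  have himage : ∀ σ : Equiv.Perm (Fin n),
      ((franklFamily k b E).image (Finset.image σ)).card = (franklFamily k b E).card := fun σ =>
    Finset.card_image_of_injective _ (Finset.image_injective σ.injective)
  constructor
  · by_contra! hlt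
    obtain ⟨σ, h⟩ := hσ hlt.le
    have := Finset.card_le_card h
    rw [himage] at this
    omega
  · intro heq
    obtain ⟨σ, h⟩ := hσ heq.ge
    exact ⟨σ, Finset.eq_of_subset_of_card_le h (by rw [himage, heq])⟩
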